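/- For positive integers $k,m,n$ let $$f_k(m,n)=\left|\left\{(a_1,\ldots,a_k)\in\mathbb{Z}_{>0}^k:\ a_1\le\cdots\le a_k,\ \frac{m}{n}=\sum_{i=1}^k\frac1{a_i}\right\}\right|$$ be the number of representations of $m/n$ as a sum of $k$ unit fractions. For every $\varepsilon>0$ there is a constant $C_\varepsilon>0$, depending only on $\varepsilon$, such that for all positive integers $m,n$ and all integers $k\ge 5$ $$f_k(m,n)\le C_\varepsilon\,(kn)^{\varepsilon}\left(\frac{k^{4/3}\,n^2}{m}\right)^{\frac85\cdot 2^{k-5}}.$$ -/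

import Mathlib

/-- The set of representations of `m / n` as a sum of `k` unit fractions with positive integer
denominators in non-decreasing order: all `(a₁, …, a_k)` with `1 ≤ a₁ ≤ … ≤ a_k` and
`m / n = 1 / a₁ + … + 1 / a_k`. -/
def unitFractionReps (k m n : ℕ) : Set (Fin k → ℕ) :=
  {a | (∀ i, 0 < a i) ∧ Monotone a ∧ (m : ℚ) / (n : ℚ) = ∑ i, 1 / (a i : ℚ)}

/-- `f_k(m, n)`: the number of representations of `m / n` as a sum of `k` unit fractions. -/
noncomputable def unitFractionCount (k m n : ℕ) : ℕ :=
  (unitFractionReps k m n).ncard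

/-- Finiteness of the solution set for an arbitrary rational left-hand side. -/
theorem finite_unitFraction_aux (k : ℕ) : ∀ q : ℚ,
    {a : Fin k → ℕ | (∀ i, 0 < a i) ∧ Monotone a ∧ q = ∑ i, 1 / (a i : ℚ)}.Finite := by
  induction k with
  | zero => intro q; exact Set.toFinite _
  | succ k ih =>
    intro q
    refine ((Set.finite_Iic ⌊((k : ℚ) + 1) / q⌋₊).biUnion
      (fun b _ => (ih (q - 1 / (b : ℚ))).image (fun t : Fin k → ℕ => (Fin.cons b t : Fin (k + 1) → ℕ)))).subset ?_
    rintro a ⟨hpos, hmono, hq⟩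
    have hq0 : 0 < q := by
      rw [hq]
      refine Finset.sum_pos (fun i _ => ?_) Finset.univ_nonempty
      have : (0 : ℚ) < a i := by exact_mod_cast hpos i
      positivity
    have h0 : (0 : ℚ) < a 0 := by exact_mod_cast hpos 0
    have hle : q ≤ ((k : ℚ) + 1) * (1 / (a 0 : ℚ)) := by
      have h1 : ∑ i, 1 / (a i : ℚ) ≤ ∑ _i : Fin (k + 1), 1 / (a 0 : ℚ) := by
        refine Finset.sum_le_sum (fun i _ => ?_)
        exact one_div_le_one_div_of_le h0 (by exact_mod_cast hmono (Fin.zero_le i))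
      rw [hq]
      simpa using h1
    simp only [Set.mem_iUnion, Set.mem_image, Set.mem_Iic, exists_prop]
    refine ⟨a 0, ?_, Fin.tail a, ⟨fun i => hpos _, fun i j hij => hmono ?_, ?_⟩, Fin.cons_self_tail a⟩
    · apply Nat.le_floor
      rw [le_div_iff₀ hq0]
      rw [mul_one_div, le_div_iff₀ h0] at hle
      linarith
    · exact Fin.succ_le_succ_iff.mpr hij
    · rw [hq, Fin.sum_univ_succ]
      simp [Fin.tail]

/-- The solution set is finite, so that `unitFractionCount` is its genuine cardinality. -/
theorem unitFractionReps_finite (k m n : ℕ) : (unitFractionReps k m n).Finite :=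
  finite_unitFraction_aux k _

/-! Write X = n²/m. The bound rests on a count for four fractions, one summation giving five, and an
induction that squares the bound at each further fraction. A bound slightly stronger than the claim
holds, with no (kn)^ε.

Four fractions. The gcd structure of the denominators gives a parametrisation (`exists_isValid`) by
divisors of few numbers. Numbers polynomial in n have O(n^ε) divisors, so fixing a few products
determines a solution up to n^ε choices. It is enough to fix g x₁ p z y₂, or the first denominator a
together with one of x₂q, y₂q, x₂y₂ or the second denominator b. If a is the least possible, b =
O(X), and since (x₂q)(y₂q)(x₂y₂) ≤ b², one of these products is O(X^(2/3)). If a is j places further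
on, put w = √(n/m), so b = O(w⁴/j). Either x₂q is O(w³/j), or the third denominator is large and
confines b to an interval of length O(w³/j), or g x₁ p z y₂ is O(w³). Summing over j gives n^ε
((n/m)^(3/2) + X^(2/3)).

Five fractions. Subtracting 1/a leaves (ma − n)/(an), where an ≤ 5X and ma − n is at least the index
of a. Summation gives X^(3/2 + 1/10) = X^(8/5).

Induction. With u = ma − n one has an = X(1 + u/n), so a bound with exponent E for k fractions gives
a sum of ((1 + u/n)²/u)^E times a factor X^(2E). That sum is at most (k + 3)((k+1)²/k)^E. The weight
k^(4/3) is chosen so that an extra ((k+1)²/k)^(E/3) is available, and this absorbs k + 3 once k ≥ 6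
(`add_three_le_rpow`). Only the step from 5 to 6 costs a constant. -/

set_option linter.unusedTactic false
set_option linter.unreachableTactic false

/-! ### The divisor bound -/

/-- The number of divisors of `n` grows slower than any power of `n`. -/
theorem exists_card_divisors_le_rpow (ε : ℝ) (hε : 0 < ε) :
    ∃ C : ℝ, 1 ≤ C ∧ ∀ n : ℕ, n ≠ 0 → (n.divisors.card : ℝ) ≤ C * (n : ℝ) ^ ε := by
  -- A prime p ≥ P has p^ε ≥ 2, so e + 1 ≤ 2^e needs no constant. The fewer than P smaller primes
  -- each cost K + 1, by 2^(εe) ≥ 1 + eε log 2.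
  obtain ⟨P, hP⟩ := exists_nat_gt ((2 : ℝ) ^ (1 / ε))
  obtain ⟨K, hK⟩ := exists_nat_gt (1 / (ε * Real.log 2))
  have hl2 : 0 < Real.log 2 := Real.log_pos (by norm_num)
  have hεl : 0 < ε * Real.log 2 := by positivity
  have hK1 : (1 : ℝ) ≤ (K : ℝ) + 1 := by
    have : (0 : ℝ) ≤ K := Nat.cast_nonneg K
    linarith
  have key : ∀ p e : ℕ, p.Prime → ((e : ℝ) + 1) ≤
      (if p < P then (K : ℝ) + 1 else 1) * ((p : ℝ) ^ e) ^ ε := by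
    intro p e hp
    have hp2 : (2 : ℝ) ≤ p := by exact_mod_cast hp.two_le
    have hp0 : (0 : ℝ) < p := by linarith
    have hsw : ((p : ℝ) ^ e) ^ ε = ((p : ℝ) ^ ε) ^ e := by
      rw [← Real.rpow_natCast, ← Real.rpow_natCast, ← Real.rpow_mul hp0.le,
        ← Real.rpow_mul hp0.le, mul_comm]
    split_ifs with h
    · have h1 : (2 : ℝ) ^ ε ≤ (p : ℝ) ^ ε := Real.rpow_le_rpow (by norm_num) hp2 hε.le
      have h2 : 1 + e * (ε * Real.log 2) ≤ ((2 : ℝ) ^ ε) ^ e := by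
        rw [← Real.rpow_natCast, ← Real.rpow_mul (by norm_num),
          Real.rpow_def_of_pos (by norm_num)]
        have := Real.add_one_le_exp (Real.log 2 * (ε * e))
        linarith
      have h3 : 1 + e * (ε * Real.log 2) ≤ ((p : ℝ) ^ ε) ^ e :=
        h2.trans (pow_le_pow_left₀ (by positivity) h1 e)
      rw [hsw]
      have h4 : 1 < K * (ε * Real.log 2) := by
        rwa [div_lt_iff₀ hεl] at hK
      have he : (0 : ℝ) ≤ e := Nat.cast_nonneg e
      calc (e : ℝ) + 1 ≤ (K + 1) * (1 + e * (ε * Real.log 2)) := by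
            nlinarith [mul_nonneg he hεl.le, Nat.cast_nonneg (α := ℝ) K, mul_le_mul_of_nonneg_left h4.le he]
        _ ≤ _ := by gcongr
    · push Not at h
      have hpP : (2 : ℝ) ^ (1 / ε) ≤ p := hP.le.trans (by exact_mod_cast h)
      have h1 : (2 : ℝ) ≤ (p : ℝ) ^ ε := by
        calc (2 : ℝ) = ((2 : ℝ) ^ (1 / ε)) ^ ε := by
              rw [← Real.rpow_mul (by norm_num), one_div_mul_cancel hε.ne', Real.rpow_one]
          _ ≤ _ := Real.rpow_le_rpow (by positivity) hpP hε.le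
      rw [hsw, one_mul]
      calc (e : ℝ) + 1 ≤ (2 : ℝ) ^ e := by exact_mod_cast Nat.lt_two_pow_self
        _ ≤ _ := pow_le_pow_left₀ (by norm_num) h1 e
  refine ⟨((K : ℝ) + 1) ^ P, one_le_pow₀ hK1, fun n hn => ?_⟩
  rw [Nat.card_divisors hn]
  push_cast
  have hn' : (n : ℝ) ^ ε = ∏ p ∈ n.primeFactors, ((p : ℝ) ^ (n.factorization p)) ^ ε := by
    rw [Real.finsetProd_rpow _ _ (fun i _ => by positivity)]
    congr 1
    conv_lhs => rw [← Nat.prod_factorization_pow_eq_self hn]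
    rw [Finsupp.prod]
    push_cast
    rfl
  rw [hn']
  calc ∏ p ∈ n.primeFactors, ((n.factorization p : ℝ) + 1)
      ≤ ∏ p ∈ n.primeFactors, (if p < P then (K : ℝ) + 1 else 1) *
          ((p : ℝ) ^ (n.factorization p)) ^ ε :=
        Finset.prod_le_prod (fun i _ => by positivity)
          fun p hp => key p _ (Nat.prime_of_mem_primeFactors hp)
    _ = (∏ p ∈ n.primeFactors, (if p < P then (K : ℝ) + 1 else 1)) *
          ∏ p ∈ n.primeFactors, ((p : ℝ) ^ (n.factorization p)) ^ ε := Finset.prod_mul_distrib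
    _ ≤ _ := by
        gcongr
        rw [← Finset.prod_filter, Finset.prod_const]
        refine pow_le_pow_right₀ hK1 ?_
        calc _ ≤ (Finset.range P).card := Finset.card_le_card fun p hp => by
              simpa using (Finset.mem_filter.mp hp).2
          _ = P := Finset.card_range P

/-! ### Counting through chains of divisors -/

/-- The position of `d` among the divisors of `N`. -/
def divisorIndex (N d : ℕ) : ℕ := (N.divisors.filter (· < d)).card

theorem divisorIndex_lt {N d : ℕ} (hN : N ≠ 0) (hd : d ∣ N) :
    divisorIndex N d < N.divisors.card := by
  refine Finset.card_lt_card ((Finset.filter_ssubset).mpr ⟨d, ?_, lt_irrefl d⟩)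
  exact Nat.mem_divisors.mpr ⟨hd, hN⟩

theorem eq_of_divisorIndex_eq {N N' d d' : ℕ} (hNN : N = N') (hN : N ≠ 0) (hd : d ∣ N)
    (hd' : d' ∣ N') (h : divisorIndex N d = divisorIndex N' d') : d = d' := by
  subst hNN
  have aux : ∀ {a b : ℕ}, a ∣ N → a < b → divisorIndex N a < divisorIndex N b := by
    intro a b ha hab
    refine Finset.card_lt_card ⟨fun x hx => ?_, fun hsub => ?_⟩
    · simp only [Finset.mem_filter] at hx ⊢
      exact ⟨hx.1, hx.2.trans hab⟩
    · have : a ∈ N.divisors.filter (· < a) :=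
        hsub (by simp [ha, hN, hab])
      simp at this
  rcases lt_trichotomy d d' with hlt | heq | hlt
  · exact absurd h (aux hd hlt).ne
  · exact heq
  · exact absurd h (aux hd' hlt).ne'

/-- If each element of `T` is determined by its image under `f` and by a list of divisors `e.2 x` of
numbers `e.1 x`, each of which has at most `D` divisors and is determined by the preceding data, then
`T` has at most `#(f '' T) * D ^ r` elements. -/
theorem card_le_card_image_mul_pow {α β : Type*} [DecidableEq β] (T : Finset α)
    (f : α → β) (L : List ((α → ℕ) × (α → ℕ))) (D : ℕ)
    (hdiv : ∀ x ∈ T, ∀ e ∈ L, e.2 x ∣ e.1 x ∧ e.1 x ≠ 0 ∧ (e.1 x).divisors.card ≤ D)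
    (hinj : ∀ x ∈ T, ∀ y ∈ T, f x = f y → (∀ e ∈ L, e.1 x = e.1 y → e.2 x = e.2 y) → x = y) :
    T.card ≤ (T.image f).card * D ^ L.length := by
  have hcard : ((T.image f) ×ˢ (Fintype.piFinset fun _ : Fin L.length => Finset.range D)).card =
      (T.image f).card * D ^ L.length := by simp [Finset.card_product]
  rw [← hcard]
  refine Finset.card_le_card_of_injOn
    (fun x => (f x, fun i => divisorIndex ((L.get i).1 x) ((L.get i).2 x))) ?_ ?_
  · intro x hx
    simp only [Finset.coe_product, Set.mem_prod, Finset.mem_coe, Fintype.mem_piFinset,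
      Finset.mem_range]
    refine ⟨Finset.mem_image_of_mem f hx, fun i => ?_⟩
    obtain ⟨h1, h2, h3⟩ := hdiv x hx _ (L.get_mem i)
    exact (divisorIndex_lt h2 h1).trans_le h3
  · intro x hx y hy hxy
    simp only [Prod.mk.injEq] at hxy
    -- Equal positions identify the divisors only once the numbers they divide agree, so `hinj`
    -- receives conditional equalities and can use them one after another.
    refine hinj x hx y hy hxy.1 fun e he hN => ?_
    obtain ⟨i, rfl⟩ := List.get_of_mem he
    exact eq_of_divisorIndex_eq hN (hdiv x hx _ he).2.1 (hdiv x hx _ he).1 (hdiv y hy _ he).1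
      (congrFun hxy.2 i)

/-! ### Parametrisation of sums of four unit fractions -/

/-- Parameters for the solutions of `m / n = 1 / a + 1 / b + 1 / c + 1 / d`. -/
@[ext] structure FourParam where
  (n₁ b₁ n₂ b₂ g c₁ c₂ c₃ x₁ y₁ p x₂ y₂ q z : ℕ)

namespace FourParam

/-- The first denominator. -/
def den₁ (P : FourParam) : ℕ := P.n₁ * P.g * (P.x₁ * P.y₁ * P.p)

/-- The second denominator. -/
def den₂ (P : FourParam) : ℕ := P.n₂ * P.g * (P.x₂ * P.y₂ * P.q)

/-- The third denominator. -/
def den₃ (P : FourParam) : ℕ := P.p * P.q * P.z * (P.c₁ * P.x₁ * P.x₂)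

/-- The fourth denominator. -/
def den₄ (P : FourParam) : ℕ := P.p * P.q * P.z * (P.c₂ * P.y₁ * P.y₂)

/-- The relations between the parameters. -/
structure IsValid (m n : ℕ) (P : FourParam) : Prop where
  n₁_pos : 0 < P.n₁
  b₁_pos : 0 < P.b₁
  n₂_pos : 0 < P.n₂
  b₂_pos : 0 < P.b₂
  g_pos : 0 < P.g
  c₁_pos : 0 < P.c₁
  c₂_pos : 0 < P.c₂
  c₃_pos : 0 < P.c₃
  x₁_pos : 0 < P.x₁
  y₁_pos : 0 < P.y₁
  p_pos : 0 < P.p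
  x₂_pos : 0 < P.x₂
  y₂_pos : 0 < P.y₂
  q_pos : 0 < P.q
  z_pos : 0 < P.z
  n₁_mul : P.n₁ * P.b₁ = n
  n₂_mul : P.n₂ * P.b₂ = n
  c_mul : P.c₁ * P.c₂ * P.c₃ = n * P.g
  coprime : P.x₂.Coprime P.y₁
  coprime' : P.x₁.Coprime P.y₂
  eqn : m * P.g * (P.x₁ * P.y₁ * P.p) * (P.x₂ * P.y₂ * P.q) * P.z =
    (P.b₁ * (P.x₂ * P.y₂ * P.q) + P.b₂ * (P.x₁ * P.y₁ * P.p)) * P.z +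
      (P.c₁ * P.x₁ * P.x₂ + P.c₂ * P.y₁ * P.y₂) * P.c₃

/-- Every representation as a sum of four unit fractions comes from parameters. -/
theorem exists_isValid {m n a b c d : ℕ} (hn : 0 < n) (ha : 0 < a) (hb : 0 < b)
    (hc : 0 < c) (hd : 0 < d)
    (h : (m : ℚ) / n = 1 / (a : ℚ) + 1 / b + 1 / c + 1 / d) :
    ∃ P : FourParam, P.IsValid m n ∧ P.den₁ = a ∧ P.den₂ = b ∧ P.den₃ = c ∧ P.den₄ = d := by
  obtain ⟨t₁, b₁, hcop₁, ha', hn₁⟩ := Nat.exists_coprime a n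
  obtain ⟨t₂, b₂, hcop₂, hb', hn₂⟩ := Nat.exists_coprime b n
  obtain ⟨s₁, s₂, hs, ht₁, ht₂⟩ := Nat.exists_coprime t₁ t₂
  obtain ⟨α, β, hαβ, hc', hd'⟩ := Nat.exists_coprime c d
  generalize a.gcd n = n₁ at *
  generalize b.gcd n = n₂ at *
  generalize t₁.gcd t₂ = g at *
  generalize c.gcd d = h₀ at *
  have hbs₁ : s₁.Coprime b₁ := Nat.Coprime.coprime_dvd_left ⟨g, ht₁⟩ hcop₁
  have hbs₂ : s₂.Coprime b₂ := Nat.Coprime.coprime_dvd_left ⟨g, ht₂⟩ hcop₂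
  subst ht₁ ht₂ ha' hb' hc' hd'
  obtain ⟨⟨hs₁0, hg0⟩, hn₁0⟩ : (0 < s₁ ∧ 0 < g) ∧ 0 < n₁ := by
    simpa [Nat.pos_iff_ne_zero, and_assoc] using ha
  obtain ⟨⟨hs₂0, -⟩, hn₂0⟩ : (0 < s₂ ∧ 0 < g) ∧ 0 < n₂ := by
    simpa [Nat.pos_iff_ne_zero, and_assoc] using hb
  obtain ⟨hα0, hh0⟩ : 0 < α ∧ 0 < h₀ := by simpa [Nat.pos_iff_ne_zero] using hc
  obtain ⟨hβ0, -⟩ : 0 < β ∧ 0 < h₀ := by simpa [Nat.pos_iff_ne_zero] using hd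
  have hb₁0 : 0 < b₁ := Nat.pos_of_ne_zero (by rintro rfl; simp at hn₁; omega)
  have hb₂0 : 0 < b₂ := Nat.pos_of_ne_zero (by rintro rfl; simp at hn₂; omega)
  have main : m * g * s₁ * s₂ * (h₀ * α * β) =
      (b₁ * s₂ + b₂ * s₁) * (h₀ * α * β) + n * g * s₁ * s₂ * (α + β) := by
    have e₁ : (1 : ℚ) / ((s₁ * g * n₁ : ℕ) : ℚ) = b₁ / (n * g * s₁) := by
      rw [hn₁]; push_cast; field_simp
    have e₂ : (1 : ℚ) / ((s₂ * g * n₂ : ℕ) : ℚ) = b₂ / (n * g * s₂) := by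
      rw [hn₂]; push_cast; field_simp
    rw [e₁, e₂] at h
    push_cast at h
    field_simp at h
    have h' : ((m * g * s₁ * s₂ * (h₀ * α * β) : ℕ) : ℚ) =
      ((b₁ * s₂ + b₂ * s₁) * (h₀ * α * β) + n * g * s₁ * s₂ * (α + β) : ℕ) := by
      push_cast
      linear_combination h
    exact_mod_cast h'
  -- D / (n g s₁ s₂) is the value left for 1/c + 1/d.
  obtain ⟨D, hD⟩ : ∃ D, m * g * s₁ * s₂ = (b₁ * s₂ + b₂ * s₁) + D := by
    refine Nat.exists_eq_add_of_le (Nat.le_of_mul_le_mul_right ?_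
      (show 0 < h₀ * α * β by positivity))
    omega
  have hDeq : D * (h₀ * α * β) = n * g * s₁ * s₂ * (α + β) := by
    rw [hD] at main
    linarith
  -- A prime dividing D and s₁ would divide b₁ s₂, but s₁ is coprime to both factors.
  have hDs₁ : D.Coprime s₁ := by
    refine Nat.Coprime.symm (Nat.coprime_of_dvd fun k hk h1 h2 => ?_)
    have h3 : k ∣ (b₁ * s₂ + b₂ * s₁) + D := by
      rw [← hD]; exact Dvd.dvd.mul_right (Dvd.dvd.mul_left h1 _) _
    have h4 : k ∣ b₁ * s₂ :=
      (Nat.dvd_add_left (Dvd.dvd.mul_left h1 b₂)).mp ((Nat.dvd_add_left h2).mp h3)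
    rcases (Nat.Prime.dvd_mul hk).mp h4 with h5 | h5
    · exact Nat.not_coprime_of_dvd_of_dvd hk.one_lt h1 h5 hbs₁
    · exact Nat.not_coprime_of_dvd_of_dvd hk.one_lt h1 h5 hs
  have hDs₂ : D.Coprime s₂ := by
    refine Nat.Coprime.symm (Nat.coprime_of_dvd fun k hk h1 h2 => ?_)
    have h3 : k ∣ (b₁ * s₂ + b₂ * s₁) + D := by
      rw [← hD]; exact Dvd.dvd.mul_left h1 _
    have h4 : k ∣ b₂ * s₁ :=
      (Nat.dvd_add_right (Dvd.dvd.mul_left h1 b₁)).mp ((Nat.dvd_add_left h2).mp h3)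
    rcases (Nat.Prime.dvd_mul hk).mp h4 with h5 | h5
    · exact Nat.not_coprime_of_dvd_of_dvd hk.one_lt h1 h5 hbs₂
    · exact Nat.not_coprime_of_dvd_of_dvd hk.one_lt h5 h1 hs
  -- For coprime α and β, αβ is coprime to α + β and can be cancelled against it in `hDeq`.
  have hdvd : α * β ∣ (n * g) * (s₁ * s₂) := by
    have h1 : (α * β).Coprime (α + β) := by
      refine Nat.Coprime.mul_left ?_ ?_
      · simpa using hαβ
      · simpa using hαβ.symm
    refine h1.dvd_of_dvd_mul_right (Dvd.intro_left (D * h₀) ?_)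
    linarith
  -- splitting off the common factors with `s₁` and `s₂`
  have split : ∀ γ : ℕ, 0 < γ → ∃ x₁ x₂ c r₁ r₂ : ℕ, γ = c * x₁ * x₂ ∧ s₁ = x₁ * r₁ ∧
      s₂ = x₂ * r₂ ∧ c.Coprime r₁ ∧ c.Coprime r₂ := by
    intro γ hγ
    obtain ⟨u, r₁, hu, h1, h2⟩ := Nat.exists_coprime γ s₁
    generalize γ.gcd s₁ = x₁ at *
    obtain ⟨v, r₂, hv, h3, h4⟩ := Nat.exists_coprime u s₂
    generalize u.gcd s₂ = x₂ at *
    refine ⟨x₁, x₂, v, r₁, r₂, by rw [h1, h3]; ring, by rw [h2]; ring, by rw [h4]; ring, ?_, hv⟩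
    exact Nat.Coprime.coprime_dvd_left ⟨x₂, h3⟩ hu
  obtain ⟨x₁, x₂, c₁, r₁, r₂, hα, hr₁, hr₂, hcr₁, hcr₂⟩ := split α hα0
  obtain ⟨y₁, y₂, c₂, r₁', r₂', hβ, hr₁', hr₂', hcr₁', hcr₂'⟩ := split β hβ0
  have hxα₁ : x₁ ∣ α := ⟨c₁ * x₂, by rw [hα]; ring⟩
  have hxα₂ : x₂ ∣ α := ⟨c₁ * x₁, by rw [hα]; ring⟩
  have hyβ₁ : y₁ ∣ β := ⟨c₂ * y₂, by rw [hβ]; ring⟩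
  have hyβ₂ : y₂ ∣ β := ⟨c₂ * y₁, by rw [hβ]; ring⟩
  have hxy₁ : x₁.Coprime y₁ :=
    (Nat.Coprime.coprime_dvd_left hxα₁ hαβ).coprime_dvd_right hyβ₁
  have hxy₂ : x₂.Coprime y₂ :=
    (Nat.Coprime.coprime_dvd_left hxα₂ hαβ).coprime_dvd_right hyβ₂
  obtain ⟨p, hp⟩ : x₁ * y₁ ∣ s₁ := hxy₁.mul_dvd_of_dvd_of_dvd ⟨r₁, hr₁⟩ ⟨r₁', hr₁'⟩
  obtain ⟨q, hq⟩ : x₂ * y₂ ∣ s₂ := hxy₂.mul_dvd_of_dvd_of_dvd ⟨r₂, hr₂⟩ ⟨r₂', hr₂'⟩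
  have pos : ∀ {u v : ℕ}, 0 < u * v → 0 < u ∧ 0 < v := fun h => 
    ⟨Nat.pos_of_mul_pos_right h, Nat.pos_of_mul_pos_left h⟩
  rw [hα] at hα0
  rw [hβ] at hβ0
  obtain ⟨hcx, hx₂0⟩ := pos hα0
  obtain ⟨hc₁0, hx₁0⟩ := pos hcx
  obtain ⟨hcy, hy₂0⟩ := pos hβ0
  obtain ⟨hc₂0, hy₁0⟩ := pos hcy
  have hp0 : 0 < p := (pos (hp ▸ hs₁0)).2
  have hq0 : 0 < q := (pos (hq ▸ hs₂0)).2
  have hpr₁ : p ∣ r₁ := ⟨y₁, Nat.eq_of_mul_eq_mul_left hx₁0 (by rw [← hr₁, hp]; ring)⟩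
  have hpr₁' : p ∣ r₁' := ⟨x₁, Nat.eq_of_mul_eq_mul_left hy₁0 (by rw [← hr₁', hp]; ring)⟩
  have hqr₂ : q ∣ r₂ := ⟨y₂, Nat.eq_of_mul_eq_mul_left hx₂0 (by rw [← hr₂, hq]; ring)⟩
  have hqr₂' : q ∣ r₂' := ⟨x₂, Nat.eq_of_mul_eq_mul_left hy₂0 (by rw [← hr₂', hq]; ring)⟩
  have hps₁ : p ∣ s₁ := ⟨x₁ * y₁, by rw [hp]; ring⟩
  have hqs₂ : q ∣ s₂ := ⟨x₂ * y₂, by rw [hq]; ring⟩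
  -- After cancelling x₁y₁x₂y₂ from `hdvd`, what remains of s₁s₂ is pq. It is coprime to c₁c₂
  -- because p divides both cofactors r₁, r₁' and q divides both r₂, r₂'.
  obtain ⟨c₃, hc₃⟩ : c₁ * c₂ ∣ n * g := by
    have h1 : (c₁ * c₂).Coprime (p * q) :=
      Nat.Coprime.mul_left
        (Nat.Coprime.mul_right (hcr₁.coprime_dvd_right hpr₁) (hcr₂.coprime_dvd_right hqr₂))
        (Nat.Coprime.mul_right (hcr₁'.coprime_dvd_right hpr₁') (hcr₂'.coprime_dvd_right hqr₂'))
    refine h1.dvd_of_dvd_mul_right ?_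
    have h2 : (x₁ * y₁ * x₂ * y₂) * (c₁ * c₂) ∣ (x₁ * y₁ * x₂ * y₂) * (n * g * (p * q)) := by
      have e1 : (x₁ * y₁ * x₂ * y₂) * (c₁ * c₂) = α * β := by rw [hα, hβ]; ring
      have e2 : (x₁ * y₁ * x₂ * y₂) * (n * g * (p * q)) = (n * g) * (s₁ * s₂) := by
        rw [hp, hq]; ring
      rw [e1, e2]; exact hdvd
    exact Nat.dvd_of_mul_dvd_mul_left (by positivity) h2
  have hc₃0 : 0 < c₃ := (pos (hc₃ ▸ Nat.mul_pos hn hg0)).2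
  have hDh : D * h₀ = c₃ * (p * q) * (α + β) := by
    refine Nat.eq_of_mul_eq_mul_left
      (show 0 < (x₁ * y₁ * x₂ * y₂) * (c₁ * c₂) by positivity) ?_
    calc (x₁ * y₁ * x₂ * y₂) * (c₁ * c₂) * (D * h₀) = D * (h₀ * α * β) := by rw [hα, hβ]; ring
      _ = (n * g) * s₁ * s₂ * (α + β) := hDeq
      _ = _ := by rw [hc₃, hp, hq]; ring
  -- Here pq divides D h₀, while D is coprime to s₁ and s₂ and hence to pq.
  obtain ⟨z, hz⟩ : p * q ∣ h₀ := by
    have h1 : (p * q).Coprime D :=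
      (Nat.Coprime.mul_right (hDs₁.coprime_dvd_right hps₁) (hDs₂.coprime_dvd_right hqs₂)).symm
    refine h1.dvd_of_dvd_mul_left ?_
    rw [hDh]
    exact ⟨c₃ * (α + β), by ring⟩
  have hz0 : 0 < z := (pos (hz ▸ hh0)).2
  have hDz : D * z = c₃ * (α + β) := by
    refine Nat.eq_of_mul_eq_mul_left (show 0 < p * q by positivity) ?_
    calc p * q * (D * z) = D * h₀ := by rw [hz]; ring
      _ = _ := by rw [hDh]; ring
  have hxs₁ : x₁ ∣ s₁ := ⟨r₁, hr₁⟩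
  have hxs₂ : x₂ ∣ s₂ := ⟨r₂, hr₂⟩
  have hys₁ : y₁ ∣ s₁ := ⟨r₁', hr₁'⟩
  have hys₂ : y₂ ∣ s₂ := ⟨r₂', hr₂'⟩
  refine ⟨⟨n₁, b₁, n₂, b₂, g, c₁, c₂, c₃, x₁, y₁, p, x₂, y₂, q, z⟩,
    ⟨hn₁0, hb₁0, hn₂0, hb₂0, hg0, hc₁0, hc₂0, hc₃0, hx₁0, hy₁0, hp0, hx₂0, hy₂0, hq0, hz0,
      by rw [hn₁]; ring, by rw [hn₂]; ring, hc₃.symm, ?_, ?_, ?_⟩, ?_, ?_, ?_, ?_⟩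
  · exact (hs.symm.coprime_dvd_left hxs₂).coprime_dvd_right hys₁
  · exact (hs.coprime_dvd_left hxs₁).coprime_dvd_right hys₂
  · simp only
    rw [← hp, ← hq, hD, add_mul, hDz, hα, hβ]; ring
  · simp only [den₁]; rw [hp]; ring
  · simp only [den₂]; rw [hq]; ring
  · simp only [den₃]; rw [hz, hα]; ring
  · simp only [den₄]; rw [hz, hβ]; ring

end FourParam

/-! ### Size bookkeeping and bilinear equations -/

/-- `a` is at most a power of `Y`; the exponent counts the factors of a polynomial expression. -/
def PowBounded (Y k a : ℕ) : Prop := a ≤ Y ^ (k + 1)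

theorem PowBounded.mul {Y j k a b : ℕ} (ha : PowBounded Y j a) (hb : PowBounded Y k b) :
    PowBounded Y (j + k + 1) (a * b) := by
  unfold PowBounded at *
  calc a * b ≤ Y ^ (j + 1) * Y ^ (k + 1) := Nat.mul_le_mul ha hb
    _ = _ := by ring

/-- Two numbers that are at least 2 have sum at most their product. A sum is thus charged like a
product, and the index can be read off the syntax of an expression. -/
theorem PowBounded.add {Y j k a b : ℕ} (hY : 2 ≤ Y) (ha : PowBounded Y j a)
    (hb : PowBounded Y k b) : PowBounded Y (j + k + 1) (a + b) := by
  unfold PowBounded at *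
  have h1 : 2 ≤ Y ^ (j + 1) := hY.trans (Nat.le_self_pow (by omega) Y)
  have h2 : 2 ≤ Y ^ (k + 1) := hY.trans (Nat.le_self_pow (by omega) Y)
  calc a + b ≤ Y ^ (j + 1) + Y ^ (k + 1) := Nat.add_le_add ha hb
    _ ≤ Y ^ (j + 1) * Y ^ (k + 1) := by nlinarith
    _ = _ := by ring

theorem PowBounded.sub {Y k a : ℕ} (b : ℕ) (ha : PowBounded Y k a) : PowBounded Y k (a - b) :=
  (Nat.sub_le a b).trans ha

theorem PowBounded.le {Y k a : ℕ} (hY : 2 ≤ Y) (r : ℕ) (ha : PowBounded Y k a) (hk : k + 1 ≤ r) :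
    a ≤ Y ^ r :=
  ha.trans (Nat.pow_le_pow_right (by omega) hk)

/-- Otherwise C y alone would be at least the left side. This keeps the natural subtraction A x - C
from truncating. -/
theorem bilinear_lt {A B C E x y : ℕ} (hE : 0 < E) (h : A * x * y = B * x + C * y + E) :
    C < A * x := by
  by_contra hlt
  push Not at hlt
  have := Nat.mul_le_mul_right y hlt
  omega

/-- A solution of `A x y = B x + C y + E` corresponds to a divisor of `A E + B C`. -/
theorem bilinear_dvd {A B C E x y : ℕ} (hE : 0 < E) (h : A * x * y = B * x + C * y + E) :
    A * x - C ∣ A * E + B * C := by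
  -- The factorisation is (A x - C)(A y - B) = A E + B C, with both factors positive.
  obtain ⟨d, hd⟩ := Nat.exists_eq_add_of_lt (bilinear_lt hE h)
  obtain ⟨f, hf⟩ := Nat.exists_eq_add_of_lt
    (bilinear_lt (A := A) (B := C) (C := B) (x := y) (y := x) hE (by linarith))
  refine ⟨f + 1, ?_⟩
  have h1 : A * x - C = d + 1 := by omega
  rw [h1]
  have h2 : (A * x) * (A * y) = A * (B * x + C * y + E) := by rw [← h]; ring
  have h3 : A * (B * x + C * y + E) = B * (A * x) + C * (A * y) + A * E := by ring
  rw [h3, hd, hf] at h2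
  linarith

/-- The value A x - C fixes x, and is then the nonzero coefficient of y. A single divisor thus
recovers two unknowns. -/
theorem bilinear_unique {A B C E x y x' y' : ℕ} (hE : 0 < E)
    (h : A * x * y = B * x + C * y + E) (h' : A * x' * y' = B * x' + C * y' + E)
    (hx : A * x - C = A * x' - C) : x = x' ∧ y = y' := by
  have l := bilinear_lt hE h
  have l' := bilinear_lt hE h'
  have e : A * x = A * x' := by omega
  have hA : 0 < A := Nat.pos_of_ne_zero (by rintro rfl; simp at l)
  have hxx : x = x' := Nat.eq_of_mul_eq_mul_left hA e
  subst hxx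
  refine ⟨rfl, ?_⟩
  obtain ⟨d, hd⟩ := Nat.exists_eq_add_of_lt l
  rw [hd] at h h'
  have : (d + 1) * y = (d + 1) * y' := by linarith
  exact Nat.eq_of_mul_eq_mul_left (by omega) this

theorem linear_unique {L R E z z' : ℕ} (hE : 0 < E) (h : L * z = R * z + E)
    (h' : L * z' = R * z' + E) : z = z' := by
  have hlt : R < L := by
    by_contra hle
    push Not at hle
    have := Nat.mul_le_mul_right z hle
    omega
  obtain ⟨d, rfl⟩ := Nat.exists_eq_add_of_lt hlt
  have : (d + 1) * z = (d + 1) * z' := by linarith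
  exact Nat.eq_of_mul_eq_mul_left (by omega) this

/-! ### Which partial data determine a solution up to divisors -/

namespace FourParam

/-- All parameters are at most `Y`. -/
structure IsBounded (Y : ℕ) (P : FourParam) : Prop where
  n₁ : PowBounded Y 0 P.n₁
  b₁ : PowBounded Y 0 P.b₁
  n₂ : PowBounded Y 0 P.n₂
  b₂ : PowBounded Y 0 P.b₂
  g : PowBounded Y 0 P.g
  c₁ : PowBounded Y 0 P.c₁
  c₂ : PowBounded Y 0 P.c₂
  c₃ : PowBounded Y 0 P.c₃
  x₁ : PowBounded Y 0 P.x₁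
  y₁ : PowBounded Y 0 P.y₁
  p : PowBounded Y 0 P.p
  x₂ : PowBounded Y 0 P.x₂
  y₂ : PowBounded Y 0 P.y₂
  q : PowBounded Y 0 P.q
  z : PowBounded Y 0 P.z

/-- Modulo x₂ only two terms of the equation survive. Both carry y₁, which is coprime to x₂. This
exhibits x₂ as a divisor of a number not involving y₁ or q. -/
theorem IsValid.dvd_aux {m n : ℕ} {P : FourParam} (V : P.IsValid m n) :
    P.x₂ ∣ P.b₂ * (P.x₁ * P.p * P.z) + P.c₂ * P.c₃ * P.y₂ := by
  refine V.coprime.dvd_of_dvd_mul_left ?_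
  have h1 : P.x₂ ∣ m * P.g * (P.x₁ * P.y₁ * P.p) * (P.x₂ * P.y₂ * P.q) * P.z :=
    ⟨m * P.g * (P.x₁ * P.y₁ * P.p) * (P.y₂ * P.q) * P.z, by ring⟩
  rw [V.eqn] at h1
  have h2 : (P.b₁ * (P.x₂ * P.y₂ * P.q) + P.b₂ * (P.x₁ * P.y₁ * P.p)) * P.z +
      (P.c₁ * P.x₁ * P.x₂ + P.c₂ * P.y₁ * P.y₂) * P.c₃ =
      P.x₂ * (P.b₁ * P.y₂ * P.q * P.z + P.c₁ * P.x₁ * P.c₃) +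
        P.y₁ * (P.b₂ * (P.x₁ * P.p * P.z) + P.c₂ * P.c₃ * P.y₂) := by ring
  rw [h2] at h1
  exact (Nat.dvd_add_right (Dvd.intro _ rfl)).mp h1

theorem IsValid.bilinear_y₁_q {m n : ℕ} {P : FourParam} (V : P.IsValid m n) :
    (m * P.g * P.x₁ * P.p * P.x₂ * P.y₂ * P.z) * P.y₁ * P.q =
      (P.b₂ * P.x₁ * P.p * P.z + P.c₂ * P.y₂ * P.c₃) * P.y₁ +
      (P.b₁ * P.x₂ * P.y₂ * P.z) * P.q + P.c₁ * P.x₁ * P.x₂ * P.c₃ := by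
  have := V.eqn
  linarith

theorem IsValid.b₁_eq {m n : ℕ} {P Q : FourParam} (V : P.IsValid m n) (W : Q.IsValid m n)
    (h : P.n₁ = Q.n₁) : P.b₁ = Q.b₁ :=
  Nat.eq_of_mul_eq_mul_left W.n₁_pos (by rw [W.n₁_mul, ← h, V.n₁_mul])

theorem IsValid.b₂_eq {m n : ℕ} {P Q : FourParam} (V : P.IsValid m n) (W : Q.IsValid m n)
    (h : P.n₂ = Q.n₂) : P.b₂ = Q.b₂ :=
  Nat.eq_of_mul_eq_mul_left W.n₂_pos (by rw [W.n₂_mul, ← h, V.n₂_mul])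

theorem IsValid.c₃_eq {m n : ℕ} {P Q : FourParam} (V : P.IsValid m n) (W : Q.IsValid m n)
    (h : P.g = Q.g) (h₁ : P.c₁ = Q.c₁) (h₂ : P.c₂ = Q.c₂) : P.c₃ = Q.c₃ :=
  Nat.eq_of_mul_eq_mul_left (Nat.mul_pos W.c₁_pos W.c₂_pos)
    (by rw [W.c_mul, ← h₁, ← h₂, V.c_mul, h])

noncomputable instance : DecidableEq FourParam := Classical.decEq _

/-- A finite family of parameters for `m / n`, all at most `Y`, together with a bound `D` for the
number of divisors of numbers of polynomial size in `Y`. -/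
structure IsFamily (m n Y D : ℕ) (T : Finset FourParam) : Prop where
  m_pos : 0 < m
  n_pos : 0 < n
  two_le : 2 ≤ Y
  m_le : PowBounded Y 0 m
  n_le : PowBounded Y 0 n
  card_le : ∀ N, N ≠ 0 → N ≤ Y ^ 30 → N.divisors.card ≤ D
  valid : ∀ P ∈ T, P.IsValid m n
  bounded : ∀ P ∈ T, P.IsBounded Y

variable {m n Y D : ℕ} {T : Finset FourParam}

theorem IsFamily.dvd_and_card_le (h : IsFamily m n Y D T) {N d k : ℕ} (h1 : d ∣ N) (h2 : 0 < N)
    (h3 : PowBounded Y k N) (h4 : k + 1 ≤ 30) : d ∣ N ∧ N ≠ 0 ∧ N.divisors.card ≤ D :=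
  ⟨h1, h2.ne', h.card_le _ h2.ne' (h3.le h.two_le 30 h4)⟩

theorem IsFamily.subset (h : IsFamily m n Y D T) {S : Finset FourParam} (hS : S ⊆ T) :
    IsFamily m n Y D S :=
  ⟨h.m_pos, h.n_pos, h.two_le, h.m_le, h.n_le, h.card_le, fun P hP => h.valid P (hS hP),
    fun P hP => h.bounded P (hS hP)⟩

/-- Fixing `g x₁ p z y₂` leaves few possibilities. -/
theorem IsFamily.card_le_of_product (hT : IsFamily m n Y D T) :
    T.card ≤ (T.image fun P => P.g * (P.x₁ * P.p * P.z) * P.y₂).card * D ^ 11 := by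
  -- The list is in order of recovery: the five factors of the fixed product, n₁ and n₂, then c₁ and
  -- c₂ (hence c₃), then x₂. The last divisor gives y₁ and q at once.
  refine card_le_card_image_mul_pow T _
    [(fun P => P.g * (P.x₁ * P.p * P.z) * P.y₂, fun P => P.g),
      (fun P => P.g * (P.x₁ * P.p * P.z) * P.y₂, fun P => P.x₁),
      (fun P => P.g * (P.x₁ * P.p * P.z) * P.y₂, fun P => P.p),
      (fun P => P.g * (P.x₁ * P.p * P.z) * P.y₂, fun P => P.z),
      (fun P => P.g * (P.x₁ * P.p * P.z) * P.y₂, fun P => P.y₂),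
      (fun _ => n, fun P => P.n₁), (fun _ => n, fun P => P.n₂),
      (fun P => n * P.g, fun P => P.c₁), (fun P => n * P.g, fun P => P.c₂),
      (fun P => P.b₂ * (P.x₁ * P.p * P.z) + P.c₂ * P.c₃ * P.y₂, fun P => P.x₂),
      (fun P => (m * P.g * P.x₁ * P.p * P.x₂ * P.y₂ * P.z) * (P.c₁ * P.x₁ * P.x₂ * P.c₃) +
        (P.b₂ * P.x₁ * P.p * P.z + P.c₂ * P.y₂ * P.c₃) * (P.b₁ * P.x₂ * P.y₂ * P.z),
       fun P => (m * P.g * P.x₁ * P.p * P.x₂ * P.y₂ * P.z) * P.y₁ - P.b₁ * P.x₂ * P.y₂ * P.z)]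
    D ?_ ?_
  · intro P hP
    have V := hT.valid P hP
    obtain ⟨_, _, _, _, _, _, _, _, _, _, _, _, _, _, _, _, _, _, _, _, _⟩ := hT.valid P hP
    obtain ⟨_, _, _, _, _, _, _, _, _, _, _, _, _, _, _⟩ := hT.bounded P hP
    have := hT.m_pos
    have := hT.n_pos
    have := hT.m_le
    have := hT.n_le
    have mul : ∀ {j k a b : ℕ}, PowBounded Y j a → PowBounded Y k b →
        PowBounded Y (j + k + 1) (a * b) := PowBounded.mul
    have add : ∀ {j k a b : ℕ}, PowBounded Y j a → PowBounded Y k b →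
        PowBounded Y (j + k + 1) (a + b) := PowBounded.add hT.two_le
    simp only [List.forall_mem_cons, List.not_mem_nil, false_imp_iff, implies_true, and_true]
    refine ⟨?_, ?_, ?_, ?_, ?_, ?_, ?_, ?_, ?_, ?_, ?_⟩
    · exact hT.dvd_and_card_le ⟨P.x₁ * P.p * P.z * P.y₂, by ring⟩ (by positivity)
        (by repeat' first | assumption | apply mul | apply add) (by norm_num)
    · exact hT.dvd_and_card_le ⟨P.g * P.p * P.z * P.y₂, by ring⟩ (by positivity)
        (by repeat' first | assumption | apply mul | apply add) (by norm_num)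
    · exact hT.dvd_and_card_le ⟨P.g * P.x₁ * P.z * P.y₂, by ring⟩ (by positivity)
        (by repeat' first | assumption | apply mul | apply add) (by norm_num)
    · exact hT.dvd_and_card_le ⟨P.g * P.x₁ * P.p * P.y₂, by ring⟩ (by positivity)
        (by repeat' first | assumption | apply mul | apply add) (by norm_num)
    · exact hT.dvd_and_card_le ⟨P.g * (P.x₁ * P.p * P.z), by ring⟩ (by positivity)
        (by repeat' first | assumption | apply mul | apply add) (by norm_num)
    · exact hT.dvd_and_card_le ⟨P.b₁, V.n₁_mul.symm⟩ (by positivity) hT.n_le (by norm_num)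
    · exact hT.dvd_and_card_le ⟨P.b₂, V.n₂_mul.symm⟩ (by positivity) hT.n_le (by norm_num)
    · exact hT.dvd_and_card_le ⟨P.c₂ * P.c₃, by rw [← V.c_mul]; ring⟩ (by positivity)
        (by repeat' first | assumption | apply mul | apply add) (by norm_num)
    · exact hT.dvd_and_card_le ⟨P.c₁ * P.c₃, by rw [← V.c_mul]; ring⟩ (by positivity)
        (by repeat' first | assumption | apply mul | apply add) (by norm_num)
    · exact hT.dvd_and_card_le V.dvd_aux (by positivity)
        (by repeat' first | assumption | apply mul | apply add) (by norm_num)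
    · exact hT.dvd_and_card_le (bilinear_dvd (by positivity) V.bilinear_y₁_q) (by positivity)
        (by repeat' first | assumption | apply mul | apply add) (by norm_num)
  · intro P hP Q hQ hf h
    have V := hT.valid P hP
    have W := hT.valid Q hQ
    simp only [List.forall_mem_cons, List.not_mem_nil, false_imp_iff, implies_true,
      and_true] at h
    obtain ⟨g, x₁, p, z, y₂, n₁, n₂, c₁, c₂, x₂, k⟩ := h
    replace g := g hf
    replace x₁ := x₁ hf
    replace p := p hf
    replace z := z hf
    replace y₂ := y₂ hf
    replace n₁ := n₁ trivial
    replace n₂ := n₂ trivial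
    replace c₁ := c₁ (by rw [g])
    replace c₂ := c₂ (by rw [g])
    have b₁ := V.b₁_eq W n₁
    have b₂ := V.b₂_eq W n₂
    have c₃ := V.c₃_eq W g c₁ c₂
    replace x₂ := x₂ (by rw [b₂, x₁, p, z, c₂, c₃, y₂])
    have k' := k (by rw [b₁, b₂, g, x₁, p, z, c₁, c₂, c₃, y₂, x₂])
    have e₁ := V.bilinear_y₁_q
    have e₂ := W.bilinear_y₁_q
    rw [b₁, b₂, g, x₁, p, z, c₁, c₂, c₃, y₂, x₂] at e₁
    rw [b₁, g, x₁, p, z, y₂, x₂] at k'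
    obtain ⟨y₁, q⟩ := bilinear_unique (Nat.mul_pos (Nat.mul_pos (Nat.mul_pos W.c₁_pos W.x₁_pos)
      W.x₂_pos) W.c₃_pos) e₁ e₂ k'
    exact FourParam.ext n₁ b₁ n₂ b₂ g c₁ c₂ c₃ x₁ y₁ p x₂ y₂ q z
end FourParam

namespace FourParam

/-- This is 1/a < m/n for the first denominator a, in terms of the parameters. -/
theorem IsValid.b₁_lt {m n : ℕ} {P : FourParam} (V : P.IsValid m n) :
    P.b₁ < m * P.g * (P.x₁ * P.y₁ * P.p) := by
  by_contra hle
  push Not at hle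
  have h1 := Nat.mul_le_mul_right (P.x₂ * P.y₂ * P.q * P.z) hle
  have h2 := V.eqn
  have h3 : 0 < (P.c₁ * P.x₁ * P.x₂ + P.c₂ * P.y₁ * P.y₂) * P.c₃ :=
    Nat.mul_pos (Nat.add_pos_left (Nat.mul_pos (Nat.mul_pos V.c₁_pos V.x₁_pos) V.x₂_pos) _)
      V.c₃_pos
  have h4 := Nat.zero_le (P.b₂ * (P.x₁ * P.y₁ * P.p) * P.z)
  linarith

/-- Moving the b₁ term to the left leaves an equation bilinear in y₂ and z, the two unknowns that
remain once the first denominator and x₂ q are fixed. -/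
theorem IsValid.bilinear_y₂_z {m n : ℕ} {P : FourParam} (V : P.IsValid m n) :
    ((m * P.g * (P.x₁ * P.y₁ * P.p) - P.b₁) * (P.x₂ * P.q)) * P.y₂ * P.z =
      (P.c₂ * P.y₁ * P.c₃) * P.y₂ + (P.b₂ * (P.x₁ * P.y₁ * P.p)) * P.z +
        P.c₁ * P.x₁ * P.x₂ * P.c₃ := by
  obtain ⟨d, hd⟩ := Nat.exists_eq_add_of_lt V.b₁_lt
  have h := V.eqn
  have e : m * P.g * (P.x₁ * P.y₁ * P.p) - P.b₁ = d + 1 := by omega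
  rw [e]
  rw [hd] at h
  linarith

/-- All other terms of the equation carry the factor z. -/
theorem IsValid.z_dvd {m n : ℕ} {P : FourParam} (V : P.IsValid m n) :
    P.z ∣ (P.c₁ * P.x₁ * P.x₂ + P.c₂ * P.y₁ * P.y₂) * P.c₃ := by
  have h1 : P.z ∣ m * P.g * (P.x₁ * P.y₁ * P.p) * (P.x₂ * P.y₂ * P.q) * P.z :=
    Dvd.intro_left _ rfl
  rw [V.eqn] at h1
  exact (Nat.dvd_add_right (Dvd.intro_left _ rfl)).mp h1

variable {m n Y D : ℕ} {T : Finset FourParam}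

/-- Fixing the first denominator and `x₂ q` leaves few possibilities. -/
theorem IsFamily.card_le_of_den₁_x₂_q (hT : IsFamily m n Y D T) :
    T.card ≤ (T.image fun P => (P.den₁, P.x₂ * P.q)).card * D ^ 11 := by
  refine card_le_card_image_mul_pow T _
    [(fun P => P.n₁ * P.g * (P.x₁ * P.y₁ * P.p), fun P => P.g),
      (fun P => P.n₁ * P.g * (P.x₁ * P.y₁ * P.p), fun P => P.x₁),
      (fun P => P.n₁ * P.g * (P.x₁ * P.y₁ * P.p), fun P => P.y₁),
      (fun P => P.n₁ * P.g * (P.x₁ * P.y₁ * P.p), fun P => P.p),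
      (fun _ => n, fun P => P.n₁),
      (fun _ => n, fun P => P.n₂),
      (fun P => n * P.g, fun P => P.c₁),
      (fun P => n * P.g, fun P => P.c₂),
      (fun P => P.x₂ * P.q, fun P => P.x₂),
      (fun P => P.x₂ * P.q, fun P => P.q),
      (fun P => ((m * P.g * (P.x₁ * P.y₁ * P.p) - P.b₁) * (P.x₂ * P.q)) * (P.c₁ * P.x₁ * P.x₂ * P.c₃) +
          (P.c₂ * P.y₁ * P.c₃) * (P.b₂ * (P.x₁ * P.y₁ * P.p)), fun P => ((m * P.g * (P.x₁ * P.y₁ * P.p) - P.b₁) * (P.x₂ * P.q)) * P.y₂ -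
          P.b₂ * (P.x₁ * P.y₁ * P.p))]
    D ?_ ?_
  · intro P hP
    have V := hT.valid P hP
    have hb₁ := V.b₁_lt
    obtain ⟨_, _, _, _, _, _, _, _, _, _, _, _, _, _, _, _, _, _, _, _, _⟩ := hT.valid P hP
    obtain ⟨_, _, _, _, _, _, _, _, _, _, _, _, _, _, _⟩ := hT.bounded P hP
    have := hT.m_pos
    have := hT.n_pos
    have := hT.m_le
    have := hT.n_le
    have mul : ∀ {j k a b : ℕ}, PowBounded Y j a → PowBounded Y k b →
        PowBounded Y (j + k + 1) (a * b) := PowBounded.mul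
    have add : ∀ {j k a b : ℕ}, PowBounded Y j a → PowBounded Y k b →
        PowBounded Y (j + k + 1) (a + b) := PowBounded.add hT.two_le
    have sub : ∀ {k a b : ℕ}, PowBounded Y k a → PowBounded Y k (a - b) := PowBounded.sub _
    simp only [List.forall_mem_cons, List.not_mem_nil, false_imp_iff, implies_true, and_true]
    refine ⟨?_, ?_, ?_, ?_, ?_, ?_, ?_, ?_, ?_, ?_, ?_⟩
    · exact hT.dvd_and_card_le ⟨P.n₁ * (P.x₁ * P.y₁ * P.p), by ring⟩ (by positivity)
        (by repeat' first | assumption | apply mul | apply add | apply sub) (by norm_num)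
    · exact hT.dvd_and_card_le ⟨P.n₁ * P.g * (P.y₁ * P.p), by ring⟩ (by positivity)
        (by repeat' first | assumption | apply mul | apply add | apply sub) (by norm_num)
    · exact hT.dvd_and_card_le ⟨P.n₁ * P.g * (P.x₁ * P.p), by ring⟩ (by positivity)
        (by repeat' first | assumption | apply mul | apply add | apply sub) (by norm_num)
    · exact hT.dvd_and_card_le ⟨P.n₁ * P.g * (P.x₁ * P.y₁), by ring⟩ (by positivity)
        (by repeat' first | assumption | apply mul | apply add | apply sub) (by norm_num)
    · exact hT.dvd_and_card_le ⟨P.b₁, V.n₁_mul.symm⟩ (by positivity) hT.n_le (by norm_num)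
    · exact hT.dvd_and_card_le ⟨P.b₂, V.n₂_mul.symm⟩ (by positivity) hT.n_le (by norm_num)
    · exact hT.dvd_and_card_le ⟨P.c₂ * P.c₃, by rw [← V.c_mul]; ring⟩ (by positivity)
        (by repeat' first | assumption | apply mul | apply add | apply sub) (by norm_num)
    · exact hT.dvd_and_card_le ⟨P.c₁ * P.c₃, by rw [← V.c_mul]; ring⟩ (by positivity)
        (by repeat' first | assumption | apply mul | apply add | apply sub) (by norm_num)
    · exact hT.dvd_and_card_le ⟨P.q, by ring⟩ (by positivity)
        (by repeat' first | assumption | apply mul | apply add | apply sub) (by norm_num)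
    · exact hT.dvd_and_card_le ⟨P.x₂, by ring⟩ (by positivity)
        (by repeat' first | assumption | apply mul | apply add | apply sub) (by norm_num)
    · exact hT.dvd_and_card_le (bilinear_dvd (by positivity) V.bilinear_y₂_z)
        (Nat.add_pos_right _ (by positivity))
        (by repeat' first | assumption | apply mul | apply add | apply sub) (by norm_num)
  · intro P hP Q hQ hf h
    have V := hT.valid P hP
    have W := hT.valid Q hQ
    simp only [List.forall_mem_cons, List.not_mem_nil, false_imp_iff, implies_true,
      and_true] at h
    obtain ⟨g, x₁, y₁, p, n₁, n₂, c₁, c₂, x₂, q, k⟩ := h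
    obtain ⟨hf₁, hf₂⟩ := Prod.mk.inj hf
    replace g := g hf₁
    replace x₁ := x₁ hf₁
    replace y₁ := y₁ hf₁
    replace p := p hf₁
    replace n₁ := n₁ trivial
    replace n₂ := n₂ trivial
    replace c₁ := c₁ (by rw [g])
    replace c₂ := c₂ (by rw [g])
    replace x₂ := x₂ hf₂
    replace q := q hf₂
    have b₁ := V.b₁_eq W n₁
    have b₂ := V.b₂_eq W n₂
    have c₃ := V.c₃_eq W g c₁ c₂
    have k' := k (by rw [b₁, b₂, g, x₁, y₁, p, c₁, c₂, c₃, x₂, q])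
    have e₁ := V.bilinear_y₂_z
    have e₂ := W.bilinear_y₂_z
    rw [b₁, b₂, g, x₁, y₁, p, c₁, c₂, c₃, x₂, q] at e₁
    rw [b₁, b₂, g, x₁, y₁, p, x₂, q] at k'
    obtain ⟨y₂, z⟩ := bilinear_unique (Nat.mul_pos (Nat.mul_pos (Nat.mul_pos W.c₁_pos W.x₁_pos)
      W.x₂_pos) W.c₃_pos) e₁ e₂ k'
    exact FourParam.ext n₁ b₁ n₂ b₂ g c₁ c₂ c₃ x₁ y₁ p x₂ y₂ q z

/-- Fixing the first denominator and `x₂ y₂` leaves few possibilities. -/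
theorem IsFamily.card_le_of_den₁_x₂_y₂ (hT : IsFamily m n Y D T) :
    T.card ≤ (T.image fun P => (P.den₁, P.x₂ * P.y₂)).card * D ^ 11 := by
  refine card_le_card_image_mul_pow T _
    [(fun P => P.n₁ * P.g * (P.x₁ * P.y₁ * P.p), fun P => P.g),
      (fun P => P.n₁ * P.g * (P.x₁ * P.y₁ * P.p), fun P => P.x₁),
      (fun P => P.n₁ * P.g * (P.x₁ * P.y₁ * P.p), fun P => P.y₁),
      (fun P => P.n₁ * P.g * (P.x₁ * P.y₁ * P.p), fun P => P.p),
      (fun _ => n, fun P => P.n₁),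
      (fun _ => n, fun P => P.n₂),
      (fun P => n * P.g, fun P => P.c₁),
      (fun P => n * P.g, fun P => P.c₂),
      (fun P => P.x₂ * P.y₂, fun P => P.x₂),
      (fun P => P.x₂ * P.y₂, fun P => P.y₂),
      (fun P => (P.c₁ * P.x₁ * P.x₂ + P.c₂ * P.y₁ * P.y₂) * P.c₃, fun P => P.z)]
    D ?_ ?_
  · intro P hP
    have V := hT.valid P hP
    have hb₁ := V.b₁_lt
    obtain ⟨_, _, _, _, _, _, _, _, _, _, _, _, _, _, _, _, _, _, _, _, _⟩ := hT.valid P hP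
    obtain ⟨_, _, _, _, _, _, _, _, _, _, _, _, _, _, _⟩ := hT.bounded P hP
    have := hT.m_pos
    have := hT.n_pos
    have := hT.m_le
    have := hT.n_le
    have mul : ∀ {j k a b : ℕ}, PowBounded Y j a → PowBounded Y k b →
        PowBounded Y (j + k + 1) (a * b) := PowBounded.mul
    have add : ∀ {j k a b : ℕ}, PowBounded Y j a → PowBounded Y k b →
        PowBounded Y (j + k + 1) (a + b) := PowBounded.add hT.two_le
    have sub : ∀ {k a b : ℕ}, PowBounded Y k a → PowBounded Y k (a - b) := PowBounded.sub _
    simp only [List.forall_mem_cons, List.not_mem_nil, false_imp_iff, implies_true, and_true]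
    refine ⟨?_, ?_, ?_, ?_, ?_, ?_, ?_, ?_, ?_, ?_, ?_⟩
    · exact hT.dvd_and_card_le ⟨P.n₁ * (P.x₁ * P.y₁ * P.p), by ring⟩ (by positivity)
        (by repeat' first | assumption | apply mul | apply add | apply sub) (by norm_num)
    · exact hT.dvd_and_card_le ⟨P.n₁ * P.g * (P.y₁ * P.p), by ring⟩ (by positivity)
        (by repeat' first | assumption | apply mul | apply add | apply sub) (by norm_num)
    · exact hT.dvd_and_card_le ⟨P.n₁ * P.g * (P.x₁ * P.p), by ring⟩ (by positivity)
        (by repeat' first | assumption | apply mul | apply add | apply sub) (by norm_num)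
    · exact hT.dvd_and_card_le ⟨P.n₁ * P.g * (P.x₁ * P.y₁), by ring⟩ (by positivity)
        (by repeat' first | assumption | apply mul | apply add | apply sub) (by norm_num)
    · exact hT.dvd_and_card_le ⟨P.b₁, V.n₁_mul.symm⟩ (by positivity) hT.n_le (by norm_num)
    · exact hT.dvd_and_card_le ⟨P.b₂, V.n₂_mul.symm⟩ (by positivity) hT.n_le (by norm_num)
    · exact hT.dvd_and_card_le ⟨P.c₂ * P.c₃, by rw [← V.c_mul]; ring⟩ (by positivity)
        (by repeat' first | assumption | apply mul | apply add | apply sub) (by norm_num)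
    · exact hT.dvd_and_card_le ⟨P.c₁ * P.c₃, by rw [← V.c_mul]; ring⟩ (by positivity)
        (by repeat' first | assumption | apply mul | apply add | apply sub) (by norm_num)
    · exact hT.dvd_and_card_le ⟨P.y₂, by ring⟩ (by positivity)
        (by repeat' first | assumption | apply mul | apply add | apply sub) (by norm_num)
    · exact hT.dvd_and_card_le ⟨P.x₂, by ring⟩ (by positivity)
        (by repeat' first | assumption | apply mul | apply add | apply sub) (by norm_num)
    · exact hT.dvd_and_card_le V.z_dvd (by positivity)
        (by repeat' first | assumption | apply mul | apply add | apply sub) (by norm_num)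
  · intro P hP Q hQ hf h
    have V := hT.valid P hP
    have W := hT.valid Q hQ
    simp only [List.forall_mem_cons, List.not_mem_nil, false_imp_iff, implies_true,
      and_true] at h
    obtain ⟨g, x₁, y₁, p, n₁, n₂, c₁, c₂, x₂, y₂, k⟩ := h
    obtain ⟨hf₁, hf₂⟩ := Prod.mk.inj hf
    replace g := g hf₁
    replace x₁ := x₁ hf₁
    replace y₁ := y₁ hf₁
    replace p := p hf₁
    replace n₁ := n₁ trivial
    replace n₂ := n₂ trivial
    replace c₁ := c₁ (by rw [g])
    replace c₂ := c₂ (by rw [g])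
    replace x₂ := x₂ hf₂
    replace y₂ := y₂ hf₂
    have b₁ := V.b₁_eq W n₁
    have b₂ := V.b₂_eq W n₂
    have c₃ := V.c₃_eq W g c₁ c₂
    have z := k (by rw [x₁, y₁, c₁, c₂, c₃, x₂, y₂])
    -- With everything else known, the equation is linear in q with a positive constant term.
    have q : P.q = Q.q := by
      have e₁ := V.eqn
      have e₂ := W.eqn
      rw [b₁, b₂, g, x₁, y₁, p, c₁, c₂, c₃, x₂, y₂, z] at e₁
      refine linear_unique (L := m * Q.g * (Q.x₁ * Q.y₁ * Q.p) * (Q.x₂ * Q.y₂) * Q.z)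
        (R := Q.b₁ * (Q.x₂ * Q.y₂) * Q.z)
        (E := Q.b₂ * (Q.x₁ * Q.y₁ * Q.p) * Q.z +
          (Q.c₁ * Q.x₁ * Q.x₂ + Q.c₂ * Q.y₁ * Q.y₂) * Q.c₃) ?_ (by linarith) (by linarith)
      exact Nat.add_pos_right _ (Nat.mul_pos (Nat.add_pos_left
        (Nat.mul_pos (Nat.mul_pos W.c₁_pos W.x₁_pos) W.x₂_pos) _) W.c₃_pos)
    exact FourParam.ext n₁ b₁ n₂ b₂ g c₁ c₂ c₃ x₁ y₁ p x₂ y₂ q z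

/-- Fixing the first two denominators leaves few possibilities. -/
theorem IsFamily.card_le_of_den₁_den₂ (hT : IsFamily m n Y D T) :
    T.card ≤ (T.image fun P => (P.den₁, P.den₂)).card * D ^ 11 := by
  refine card_le_card_image_mul_pow T _
    [(fun P => P.n₁ * P.g * (P.x₁ * P.y₁ * P.p), fun P => P.g),
      (fun P => P.n₁ * P.g * (P.x₁ * P.y₁ * P.p), fun P => P.x₁),
      (fun P => P.n₁ * P.g * (P.x₁ * P.y₁ * P.p), fun P => P.y₁),
      (fun P => P.n₁ * P.g * (P.x₁ * P.y₁ * P.p), fun P => P.p),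
      (fun _ => n, fun P => P.n₁),
      (fun _ => n, fun P => P.n₂),
      (fun P => n * P.g, fun P => P.c₁),
      (fun P => n * P.g, fun P => P.c₂),
      (fun P => P.n₂ * P.g * (P.x₂ * P.y₂ * P.q), fun P => P.x₂),
      (fun P => P.n₂ * P.g * (P.x₂ * P.y₂ * P.q), fun P => P.y₂),
      (fun P => P.n₂ * P.g * (P.x₂ * P.y₂ * P.q), fun P => P.q)]
    D ?_ ?_
  · intro P hP
    have V := hT.valid P hP
    have hb₁ := V.b₁_lt
    obtain ⟨_, _, _, _, _, _, _, _, _, _, _, _, _, _, _, _, _, _, _, _, _⟩ := hT.valid P hP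
    obtain ⟨_, _, _, _, _, _, _, _, _, _, _, _, _, _, _⟩ := hT.bounded P hP
    have := hT.m_pos
    have := hT.n_pos
    have := hT.m_le
    have := hT.n_le
    have mul : ∀ {j k a b : ℕ}, PowBounded Y j a → PowBounded Y k b →
        PowBounded Y (j + k + 1) (a * b) := PowBounded.mul
    have add : ∀ {j k a b : ℕ}, PowBounded Y j a → PowBounded Y k b →
        PowBounded Y (j + k + 1) (a + b) := PowBounded.add hT.two_le
    have sub : ∀ {k a b : ℕ}, PowBounded Y k a → PowBounded Y k (a - b) := PowBounded.sub _
    simp only [List.forall_mem_cons, List.not_mem_nil, false_imp_iff, implies_true, and_true]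
    refine ⟨?_, ?_, ?_, ?_, ?_, ?_, ?_, ?_, ?_, ?_, ?_⟩
    · exact hT.dvd_and_card_le ⟨P.n₁ * (P.x₁ * P.y₁ * P.p), by ring⟩ (by positivity)
        (by repeat' first | assumption | apply mul | apply add | apply sub) (by norm_num)
    · exact hT.dvd_and_card_le ⟨P.n₁ * P.g * (P.y₁ * P.p), by ring⟩ (by positivity)
        (by repeat' first | assumption | apply mul | apply add | apply sub) (by norm_num)
    · exact hT.dvd_and_card_le ⟨P.n₁ * P.g * (P.x₁ * P.p), by ring⟩ (by positivity)
        (by repeat' first | assumption | apply mul | apply add | apply sub) (by norm_num)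
    · exact hT.dvd_and_card_le ⟨P.n₁ * P.g * (P.x₁ * P.y₁), by ring⟩ (by positivity)
        (by repeat' first | assumption | apply mul | apply add | apply sub) (by norm_num)
    · exact hT.dvd_and_card_le ⟨P.b₁, V.n₁_mul.symm⟩ (by positivity) hT.n_le (by norm_num)
    · exact hT.dvd_and_card_le ⟨P.b₂, V.n₂_mul.symm⟩ (by positivity) hT.n_le (by norm_num)
    · exact hT.dvd_and_card_le ⟨P.c₂ * P.c₃, by rw [← V.c_mul]; ring⟩ (by positivity)
        (by repeat' first | assumption | apply mul | apply add | apply sub) (by norm_num)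
    · exact hT.dvd_and_card_le ⟨P.c₁ * P.c₃, by rw [← V.c_mul]; ring⟩ (by positivity)
        (by repeat' first | assumption | apply mul | apply add | apply sub) (by norm_num)
    · exact hT.dvd_and_card_le ⟨P.n₂ * P.g * (P.y₂ * P.q), by ring⟩ (by positivity)
        (by repeat' first | assumption | apply mul | apply add | apply sub) (by norm_num)
    · exact hT.dvd_and_card_le ⟨P.n₂ * P.g * (P.x₂ * P.q), by ring⟩ (by positivity)
        (by repeat' first | assumption | apply mul | apply add | apply sub) (by norm_num)
    · exact hT.dvd_and_card_le ⟨P.n₂ * P.g * (P.x₂ * P.y₂), by ring⟩ (by positivity)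
        (by repeat' first | assumption | apply mul | apply add | apply sub) (by norm_num)
  · intro P hP Q hQ hf h
    have V := hT.valid P hP
    have W := hT.valid Q hQ
    simp only [List.forall_mem_cons, List.not_mem_nil, false_imp_iff, implies_true,
      and_true] at h
    obtain ⟨g, x₁, y₁, p, n₁, n₂, c₁, c₂, x₂, y₂, q⟩ := h
    obtain ⟨hf₁, hf₂⟩ := Prod.mk.inj hf
    replace g := g hf₁
    replace x₁ := x₁ hf₁
    replace y₁ := y₁ hf₁
    replace p := p hf₁
    replace n₁ := n₁ trivial
    replace n₂ := n₂ trivial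
    replace c₁ := c₁ (by rw [g])
    replace c₂ := c₂ (by rw [g])
    replace x₂ := x₂ hf₂
    replace y₂ := y₂ hf₂
    replace q := q hf₂
    have b₁ := V.b₁_eq W n₁
    have b₂ := V.b₂_eq W n₂
    have c₃ := V.c₃_eq W g c₁ c₂
    have z : P.z = Q.z := by
      have e₁ := V.eqn
      have e₂ := W.eqn
      rw [b₁, b₂, g, x₁, y₁, p, c₁, c₂, c₃, x₂, y₂, q] at e₁
      exact linear_unique (Nat.mul_pos (Nat.add_pos_left
        (Nat.mul_pos (Nat.mul_pos W.c₁_pos W.x₁_pos) W.x₂_pos) _) W.c₃_pos) e₁ e₂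
    exact FourParam.ext n₁ b₁ n₂ b₂ g c₁ c₂ c₃ x₁ y₁ p x₂ y₂ q z

/-- Exchanging the roles of the last two denominators. -/
def swap (P : FourParam) : FourParam :=
  ⟨P.n₁, P.b₁, P.n₂, P.b₂, P.g, P.c₂, P.c₁, P.c₃, P.y₁, P.x₁, P.p, P.y₂, P.x₂, P.q, P.z⟩

theorem swap_injective : Function.Injective swap := fun P Q h => by
  have h' := congrArg swap h
  exact h'

theorem IsValid.swap {m n : ℕ} {P : FourParam} (V : P.IsValid m n) : P.swap.IsValid m n where
  n₁_pos := V.n₁_pos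
  b₁_pos := V.b₁_pos
  n₂_pos := V.n₂_pos
  b₂_pos := V.b₂_pos
  g_pos := V.g_pos
  c₁_pos := V.c₂_pos
  c₂_pos := V.c₁_pos
  c₃_pos := V.c₃_pos
  x₁_pos := V.y₁_pos
  y₁_pos := V.x₁_pos
  p_pos := V.p_pos
  x₂_pos := V.y₂_pos
  y₂_pos := V.x₂_pos
  q_pos := V.q_pos
  z_pos := V.z_pos
  n₁_mul := V.n₁_mul
  n₂_mul := V.n₂_mul
  c_mul := by
    have := V.c_mul
    simp only [FourParam.swap]
    linarith
  -- The second coprimality condition makes validity symmetric under the exchange.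
  coprime := V.coprime'.symm
  coprime' := V.coprime.symm
  eqn := by have := V.eqn; simp only [FourParam.swap]; linarith

theorem IsFamily.image_swap (hT : IsFamily m n Y D T) : IsFamily m n Y D (T.image swap) where
  m_pos := hT.m_pos
  n_pos := hT.n_pos
  two_le := hT.two_le
  m_le := hT.m_le
  n_le := hT.n_le
  card_le := hT.card_le
  valid P hP := by
    obtain ⟨Q, hQ, rfl⟩ := Finset.mem_image.mp hP
    exact (hT.valid Q hQ).swap
  bounded P hP := by
    obtain ⟨Q, hQ, rfl⟩ := Finset.mem_image.mp hP
    obtain ⟨h1, h2, h3, h4, h5, h6, h7, h8, h9, h10, h11, h12, h13, h14, h15⟩ := hT.bounded Q hQ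
    exact ⟨h1, h2, h3, h4, h5, h7, h6, h8, h10, h9, h11, h13, h12, h14, h15⟩

/-- Fixing the first denominator and `y₂ q` leaves few possibilities. -/
theorem IsFamily.card_le_of_den₁_y₂_q (hT : IsFamily m n Y D T) :
    T.card ≤ (T.image fun P => (P.den₁, P.y₂ * P.q)).card * D ^ 11 := by
  have h := hT.image_swap.card_le_of_den₁_x₂_q
  rw [Finset.card_image_of_injective _ swap_injective, Finset.image_image] at h
  have e : (fun P : FourParam => (P.den₁, P.x₂ * P.q)) ∘ swap =
      fun P => (P.den₁, P.y₂ * P.q) := by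
    funext P
    simp only [Function.comp_apply, den₁, swap, mul_comm]
  rwa [e] at h

end FourParam

/-! ### Sizes of the denominators and parameters -/

namespace FourParam

/-- The representations of `m / n` as a sum of four unit fractions, as parameters. -/
theorem exists_finset (m n : ℕ) (hn : 0 < n) :
    ∃ T : Finset FourParam, T.card = unitFractionCount 4 m n ∧
      ∀ P ∈ T, P.IsValid m n ∧ P.den₁ ≤ P.den₂ ∧ P.den₂ ≤ P.den₃ ∧ P.den₃ ≤ P.den₄ ∧
        (m : ℚ) / n = 1 / (P.den₁ : ℚ) + 1 / P.den₂ + 1 / P.den₃ + 1 / P.den₄ := by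
  have h : ∀ a : Fin 4 → ℕ, a ∈ unitFractionReps 4 m n → ∃ P : FourParam, P.IsValid m n ∧
      P.den₁ = a 0 ∧ P.den₂ = a 1 ∧ P.den₃ = a 2 ∧ P.den₄ = a 3 := by
    rintro a ⟨hpos, -, hsum⟩
    rw [Fin.sum_univ_four] at hsum
    exact exists_isValid hn (hpos 0) (hpos 1) (hpos 2) (hpos 3) hsum
  have : Nonempty FourParam := ⟨⟨1, 1, 1, 1, 1, 1, 1, 1, 1, 1, 1, 1, 1, 1, 1⟩⟩
  choose! f hf using h
  have hfin := unitFractionReps_finite 4 m n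
  refine ⟨hfin.toFinset.image f, ?_, ?_⟩
  · rw [Finset.card_image_of_injOn, unitFractionCount, Set.ncard_eq_toFinset_card _ hfin]
    intro a ha b hb hab
    simp only [Set.Finite.coe_toFinset] at ha hb
    obtain ⟨-, h0, h1, h2, h3⟩ := hf a ha
    obtain ⟨-, g0, g1, g2, g3⟩ := hf b hb
    rw [hab] at h0 h1 h2 h3
    funext i
    fin_cases i
    exacts [h0.symm.trans g0, h1.symm.trans g1, h2.symm.trans g2, h3.symm.trans g3]
  · intro P hP
    obtain ⟨a, ha, rfl⟩ := Finset.mem_image.mp hP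
    rw [Set.Finite.mem_toFinset] at ha
    obtain ⟨V, h0, h1, h2, h3⟩ := hf a ha
    obtain ⟨hpos, hmono, hsum⟩ := ha
    rw [h0, h1, h2, h3]
    refine ⟨V, hmono (by decide), hmono (by decide), hmono (by decide), ?_⟩
    rw [hsum, Fin.sum_univ_four]

end FourParam

/-- Size of the denominators of a sum of four unit fractions. -/
theorem four_unit_fractions_le {m n a b c d : ℕ} (hn : 0 < n) (hm : 0 < m) (ha : 0 < a)
    (hab : a ≤ b) (hbc : b ≤ c) (hcd : c ≤ d)
    (h : (m : ℚ) / n = 1 / (a : ℚ) + 1 / b + 1 / c + 1 / d) :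
    m ≤ 4 * n ∧ a ≤ 4 * n ∧ b ≤ 12 * n ^ 2 ∧ c ≤ 96 * n ^ 4 ∧ d ≤ 4608 * n ^ 8 := by
  have hb : 0 < b := ha.trans_le hab
  have hc : 0 < c := hb.trans_le hbc
  have hd : 0 < d := hc.trans_le hcd
  have main : m * a * b * c * d = n * (b * c * d + a * c * d + a * b * d + a * b * c) := by
    field_simp at h
    have h' : ((m * a * b * c * d : ℕ) : ℚ) =
        (n * (b * c * d + a * c * d + a * b * d + a * b * c) : ℕ) := by
      push_cast
      linear_combination h
    exact_mod_cast h'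
  have h1 : m * a ≤ 4 * n := by
    refine Nat.le_of_mul_le_mul_right ?_ (show 0 < b * c * d by positivity)
    have e1 : a * c * d ≤ b * c * d := by gcongr
    have e2 : a * b * d ≤ c * b * d := by gcongr; omega
    have e3 : a * b * c ≤ d * b * c := by gcongr; omega
    calc m * a * (b * c * d) = n * (b * c * d + a * c * d + a * b * d + a * b * c) := by
          rw [← main]; ring
      _ ≤ n * (b * c * d + b * c * d + c * b * d + d * b * c) := by gcongr
      _ = _ := by ring
  have hm4 : m ≤ 4 * n := (Nat.le_mul_of_pos_right m ha).trans h1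
  have ha4 : a ≤ 4 * n := (Nat.le_mul_of_pos_left a hm).trans h1
  -- The remainder m/n - 1/a is u/(na) with u ≥ 1, and 1/b is at least a third of it. The bounds for
  -- c and d repeat this with two fractions and one.
  have hb' : b ≤ 3 * (n * a) := by
    obtain ⟨u, hu⟩ : ∃ u, m * a = n + u := by
      refine Nat.exists_eq_add_of_le (Nat.le_of_mul_le_mul_right ?_
        (show 0 < b * c * d by positivity))
      calc n * (b * c * d) ≤ n * (b * c * d + a * c * d + a * b * d + a * b * c) := by
            gcongr; omega
        _ = _ := by rw [← main]; ring
    have hu' : u * (b * c * d) = n * a * (c * d + b * d + b * c) := by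
      have : (n + u) * (b * c * d) = n * (b * c * d) + n * a * (c * d + b * d + b * c) := by
        rw [← hu]; linarith
      linarith
    have hu0 : 0 < u := Nat.pos_of_ne_zero (by
      rintro rfl
      have : 0 < n * a * (c * d + b * d + b * c) := by positivity
      omega)
    refine Nat.le_of_mul_le_mul_right ?_ (show 0 < c * d by positivity)
    have e2 : b * d ≤ c * d := by gcongr
    have e3 : b * c ≤ c * d := by rw [mul_comm c d]; gcongr; omega
    calc b * (c * d) = 1 * (b * c * d) := by ring
      _ ≤ u * (b * c * d) := by gcongr; omega
      _ ≤ n * a * (c * d + c * d + c * d) := by rw [hu']; gcongr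
      _ = _ := by ring
  have hc' : c ≤ 2 * (n * a * b) := by
    obtain ⟨u, hu⟩ : ∃ u, m * a * b = n * (a + b) + u := by
      refine Nat.exists_eq_add_of_le (Nat.le_of_mul_le_mul_right ?_
        (show 0 < c * d by positivity))
      calc n * (a + b) * (c * d) = n * (b * c * d + a * c * d) := by ring
        _ ≤ n * (b * c * d + a * c * d + a * b * d + a * b * c) := by
            refine Nat.mul_le_mul_left n ?_; omega
        _ = _ := by rw [← main]; ring
    have hu' : u * (c * d) = n * a * b * (c + d) := by
      have : (n * (a + b) + u) * (c * d) = n * (a + b) * (c * d) + n * a * b * (c + d) := by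
        rw [← hu]; linarith
      linarith
    have hu0 : 0 < u := Nat.pos_of_ne_zero (by
      rintro rfl
      have : 0 < n * a * b * (c + d) := by positivity
      omega)
    refine Nat.le_of_mul_le_mul_right ?_ hd
    calc c * d = 1 * (c * d) := by ring
      _ ≤ u * (c * d) := by gcongr; omega
      _ ≤ n * a * b * (d + d) := by rw [hu']; gcongr
      _ = _ := by ring
  have hd' : d ≤ n * a * b * c := by
    obtain ⟨u, hu⟩ : ∃ u, m * a * b * c = n * (b * c + a * c + a * b) + u := by
      refine Nat.exists_eq_add_of_le (Nat.le_of_mul_le_mul_right ?_ hd)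
      calc n * (b * c + a * c + a * b) * d = n * (b * c * d + a * c * d + a * b * d) := by ring
        _ ≤ n * (b * c * d + a * c * d + a * b * d + a * b * c) := by
            refine Nat.mul_le_mul_left n ?_; omega
        _ = _ := by rw [← main]
    have hu' : u * d = n * a * b * c := by
      have : (n * (b * c + a * c + a * b) + u) * d =
          n * (b * c + a * c + a * b) * d + n * a * b * c := by
        rw [← hu]; linarith
      linarith
    have hu0 : 0 < u := Nat.pos_of_ne_zero (by
      rintro rfl
      have : 0 < n * a * b * c := by positivity
      omega)
    calc d = 1 * d := by ring
      _ ≤ u * d := by gcongr; omega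
      _ = _ := hu'
  have hb'' : b ≤ 12 * n ^ 2 :=
    calc b ≤ 3 * (n * a) := hb'
      _ ≤ 3 * (n * (4 * n)) := by gcongr
      _ = _ := by ring
  have hc'' : c ≤ 96 * n ^ 4 :=
    calc c ≤ 2 * (n * a * b) := hc'
      _ ≤ 2 * (n * (4 * n) * (12 * n ^ 2)) := by gcongr
      _ = _ := by ring
  refine ⟨hm4, ha4, hb'', hc'', ?_⟩
  calc d ≤ n * a * b * c := hd'
    _ ≤ n * (4 * n) * (12 * n ^ 2) * (96 * n ^ 4) := by gcongr
    _ = _ := by ring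

/-- Position of the second denominator of a sum of four unit fractions, given the first. -/
theorem four_unit_fractions_second {m n a b c d : ℝ} (hn : 0 < n) (ha : 0 < a)
    (hab : a ≤ b) (hbc : b ≤ c) (hcd : c ≤ d) (h : m / n = 1 / a + 1 / b + 1 / c + 1 / d) :
    0 < m * a - n ∧ m * a ≤ 4 * n ∧ a * n / (m * a - n) < b ∧ b ≤ 3 * (a * n / (m * a - n)) ∧
      b ≤ a * n / (m * a - n) + 6 * (a * n / (m * a - n)) ^ 2 / c := by
  have hb : 0 < b := ha.trans_le hab
  have hc : 0 < c := hb.trans_le hbc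
  have hd : 0 < d := hc.trans_le hcd
  have i1 : 1 / b ≤ 1 / a := one_div_le_one_div_of_le ha hab
  have i2 : 1 / c ≤ 1 / b := one_div_le_one_div_of_le hb hbc
  have i3 : 1 / d ≤ 1 / c := one_div_le_one_div_of_le hc hcd
  have pa : 0 < 1 / a := by positivity
  have pb : 0 < 1 / b := by positivity
  have pc : 0 < 1 / c := by positivity
  have pd : 0 < 1 / d := by positivity
  have hu : (m * a - n) / (a * n) = 1 / b + 1 / c + 1 / d := by
    have : (m * a - n) / (a * n) = m / n - 1 / a := by field_simp
    rw [this, h]; ring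
  have hu0 : 0 < m * a - n := by
    have : 0 < (m * a - n) / (a * n) := by rw [hu]; positivity
    exact (div_pos_iff_of_pos_right (by positivity)).mp this
  -- The quantity a n / (m a - n), later called l, is the reciprocal of the remainder. So b exceeds
  -- l, and by little when c is large.
  have hl : 1 / (a * n / (m * a - n)) = 1 / b + 1 / c + 1 / d := by rw [← hu]; field_simp
  have hl0 : 0 < a * n / (m * a - n) := by positivity
  have hma : m * a ≤ 4 * n := by
    have : m / n ≤ 4 * (1 / a) := by rw [h]; linarith
    rw [mul_one_div, div_le_div_iff₀ hn ha] at this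
    exact this
  generalize a * n / (m * a - n) = l at *
  have hb3 : b ≤ 3 * l := by
    have : 1 / l ≤ 3 * (1 / b) := by rw [hl]; linarith
    rw [mul_one_div, div_le_div_iff₀ hl0 hb] at this
    linarith
  refine ⟨hu0, hma, lt_of_one_div_lt_one_div hb (by linarith), hb3, ?_⟩
  have e : b - l = b * l * (1 / l - 1 / b) := by field_simp
  have e2 : 1 / l - 1 / b ≤ 2 * (1 / c) := by linarith
  have : b * l * (1 / l - 1 / b) ≤ (3 * l) * l * (2 * (1 / c)) := by
    gcongr
    linarith
  calc b = l + (b - l) := by ring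
    _ ≤ l + (3 * l) * l * (2 * (1 / c)) := by linarith
    _ = _ := by ring

namespace FourParam

/-- The parameters are bounded in terms of the denominators. -/
theorem IsValid.isBounded {m n Y : ℕ} {P : FourParam} (V : P.IsValid m n) (hn : 0 < n)
    (hY : n ≤ Y) (h₁ : n * P.den₁ ≤ Y) (h₂ : P.den₂ ≤ Y) (h₃ : P.den₃ ≤ Y)
    (h₄ : P.den₄ ≤ Y) : P.IsBounded Y := by
  have le : ∀ {x N : ℕ}, N ≤ Y → 0 < N → x ∣ N → PowBounded Y 0 x := fun h h0 hd => by
    simpa [PowBounded] using (Nat.le_of_dvd h0 hd).trans h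
  obtain ⟨_, _, _, _, _, _, _, _, _, _, _, _, _, _, _, _, _, _, _, _, _⟩ := id V
  have p₁ : 0 < n * P.den₁ := by unfold den₁; positivity
  have p₂ : 0 < P.den₂ := by unfold den₂; positivity
  have p₃ : 0 < P.den₃ := by unfold den₃; positivity
  have p₄ : 0 < P.den₄ := by unfold den₄; positivity
  refine ⟨le hY hn ⟨_, V.n₁_mul.symm⟩, le hY hn ⟨P.n₁, by rw [← V.n₁_mul]; ring⟩,
    le hY hn ⟨_, V.n₂_mul.symm⟩, le hY hn ⟨P.n₂, by rw [← V.n₂_mul]; ring⟩,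
    le h₁ p₁ ⟨n * P.n₁ * (P.x₁ * P.y₁ * P.p), by rw [den₁]; ring⟩,
    le h₃ p₃ ⟨P.p * P.q * P.z * P.x₁ * P.x₂, by rw [den₃]; ring⟩,
    le h₄ p₄ ⟨P.p * P.q * P.z * P.y₁ * P.y₂, by rw [den₄]; ring⟩,
    le h₁ p₁ ⟨P.c₁ * P.c₂ * (P.n₁ * (P.x₁ * P.y₁ * P.p)), ?_⟩,
    le h₁ p₁ ⟨n * P.n₁ * P.g * (P.y₁ * P.p), by rw [den₁]; ring⟩,
    le h₁ p₁ ⟨n * P.n₁ * P.g * (P.x₁ * P.p), by rw [den₁]; ring⟩,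
    le h₁ p₁ ⟨n * P.n₁ * P.g * (P.x₁ * P.y₁), by rw [den₁]; ring⟩,
    le h₂ p₂ ⟨P.n₂ * P.g * (P.y₂ * P.q), by rw [den₂]; ring⟩,
    le h₂ p₂ ⟨P.n₂ * P.g * (P.x₂ * P.q), by rw [den₂]; ring⟩,
    le h₂ p₂ ⟨P.n₂ * P.g * (P.x₂ * P.y₂), by rw [den₂]; ring⟩,
    le h₃ p₃ ⟨P.p * P.q * (P.c₁ * P.x₁ * P.x₂), by rw [den₃]; ring⟩⟩
  -- The number c₃ divides n g but need not divide the first denominator, which is why `h₁` bounds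
  -- `n * P.den₁`.
  calc n * P.den₁ = (n * P.g) * (P.n₁ * (P.x₁ * P.y₁ * P.p)) := by rw [den₁]; ring
    _ = _ := by rw [← V.c_mul]; ring

end FourParam

/-! ### The bound for four fractions -/

namespace FourParam

variable {m n Y D : ℕ} {T : Finset FourParam}

/-- The denominators are in increasing order and their reciprocals sum to `m / n`. -/
def IsOrdered (m n : ℕ) (P : FourParam) : Prop :=
  P.den₁ ≤ P.den₂ ∧ P.den₂ ≤ P.den₃ ∧ P.den₃ ≤ P.den₄ ∧
    (m : ℚ) / n = 1 / (P.den₁ : ℚ) + 1 / P.den₂ + 1 / P.den₃ + 1 / P.den₄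

theorem IsValid.den₁_pos {P : FourParam} (V : P.IsValid m n) : 0 < P.den₁ := by
  obtain ⟨_, _, _, _, _, _, _, _, _, _, _, _, _, _, _, _, _, _, _, _, _⟩ := V
  unfold den₁
  positivity

theorem IsOrdered.second {P : FourParam} (hP : P.IsOrdered m n) (V : P.IsValid m n)
    (hn : 0 < n) : 0 < (m : ℝ) * P.den₁ - n ∧ (m : ℝ) * P.den₁ ≤ 4 * n ∧
      (P.den₁ : ℝ) * n / (m * P.den₁ - n) < P.den₂ ∧
      (P.den₂ : ℝ) ≤ 3 * (P.den₁ * n / (m * P.den₁ - n)) ∧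
      (P.den₂ : ℝ) ≤ P.den₁ * n / (m * P.den₁ - n) +
        6 * (P.den₁ * n / (m * P.den₁ - n)) ^ 2 / P.den₃ := by
  obtain ⟨h1, h2, h3, h4⟩ := hP
  refine four_unit_fractions_second (d := P.den₄) (by exact_mod_cast hn)
    (by exact_mod_cast V.den₁_pos) (by exact_mod_cast h1) (by exact_mod_cast h2)
    (by exact_mod_cast h3) ?_
  have := congrArg (fun x : ℚ => (x : ℝ)) h4
  push_cast at this
  exact this

/-- The first denominator is `⌊n / m⌋ + 1 + j` with `j ≤ 4 n / m`. -/
theorem IsOrdered.first {P : FourParam} (hP : P.IsOrdered m n) (V : P.IsValid m n)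
    (hn : 0 < n) (hm : 0 < m) : ∃ j ≤ 4 * n / m, P.den₁ = n / m + 1 + j ∧
      (m : ℝ) * j + 1 ≤ m * P.den₁ - n := by
  obtain ⟨h1, h2, -⟩ := hP.second V hn
  have h1' : n < m * P.den₁ := by
    have : (n : ℝ) < m * P.den₁ := by linarith
    exact_mod_cast this
  have h2' : m * P.den₁ ≤ 4 * n := by exact_mod_cast h2
  obtain ⟨j, hj⟩ := Nat.exists_eq_add_of_lt (Nat.div_lt_of_lt_mul h1')
  refine ⟨j, ?_, by omega, ?_⟩
  · have : P.den₁ ≤ 4 * n / m := (Nat.le_div_iff_mul_le hm).mpr (by linarith)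
    refine le_trans ?_ this
    rw [hj]
    exact (Nat.le_add_left j (n / m)).trans (Nat.le_succ _)
  · have h3 := Nat.lt_mul_div_succ n hm
    have h4 : m * j + 1 + n ≤ m * P.den₁ := by
      rw [hj]
      calc m * j + 1 + n ≤ m * j + m * (n / m + 1) := by omega
        _ = _ := by ring
    have : (m : ℝ) * j + 1 + n ≤ m * P.den₁ := by exact_mod_cast h4
    linarith

/-- The index j fixes the first denominator and leaves at most ⌊R j⌋ positive values of f. -/
theorem card_image_den₁_le (S : Finset FourParam) (f : FourParam → ℕ) (J : Finset ℕ)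
    (A : ℕ → ℕ) (R : ℕ → ℝ) (hR : ∀ j ∈ J, 0 ≤ R j)
    (h : ∀ P ∈ S, ∃ j ∈ J, P.den₁ = A j ∧ 0 < f P ∧ (f P : ℝ) ≤ R j) :
    ((S.image fun P => (P.den₁, f P)).card : ℝ) ≤ ∑ j ∈ J, R j := by
  have hsub : (S.image fun P => (P.den₁, f P)) ⊆
      J.biUnion fun j => {A j} ×ˢ Finset.Icc 1 ⌊R j⌋₊ := by
    intro x hx
    obtain ⟨P, hP, rfl⟩ := Finset.mem_image.mp hx
    obtain ⟨j, hj, h1, h2, h3⟩ := h P hP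
    simp only [Finset.mem_biUnion, Finset.mem_product, Finset.mem_singleton, Finset.mem_Icc]
    exact ⟨j, hj, h1, h2, Nat.le_floor h3⟩
  have h1 := (Finset.card_le_card hsub).trans Finset.card_biUnion_le
  calc ((S.image fun P => (P.den₁, f P)).card : ℝ)
      ≤ ((∑ j ∈ J, ({A j} ×ˢ Finset.Icc 1 ⌊R j⌋₊ : Finset (ℕ × ℕ)).card : ℕ) : ℝ) := by
        exact_mod_cast h1
    _ = ∑ j ∈ J, (⌊R j⌋₊ : ℝ) := by
        push_cast
        refine Finset.sum_congr rfl fun j _ => ?_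
        simp
    _ ≤ _ := Finset.sum_le_sum fun j hj => Nat.floor_le (hR j hj)

/-- Few solutions share the first denominator. -/
theorem IsFamily.card_le_of_den₁ (hT : IsFamily m n Y D T) (A : ℕ) (V : ℝ) (hV : 0 ≤ V)
    (hA : ∀ P ∈ T, P.den₁ = A) (hden : ∀ P ∈ T, (P.den₂ : ℝ) ≤ V) :
    (T.card : ℝ) ≤ 3 * V ^ ((2 : ℝ) / 3) * D ^ 11 := by
  set R : ℝ := V ^ ((2 : ℝ) / 3) with hRdef
  have hR0 : 0 ≤ R := Real.rpow_nonneg hV _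
  have hR3 : R ^ 3 = V ^ 2 := by
    rw [hRdef, ← Real.rpow_natCast, ← Real.rpow_mul hV, ← Real.rpow_natCast]
    norm_num
  have aux : ∀ f : FourParam → ℕ, (∀ P ∈ T, 0 < f P) →
      (((T.filter fun P => (f P : ℝ) ≤ R).image fun P => (P.den₁, f P)).card : ℝ) ≤ R := by
    intro f hf
    have := card_image_den₁_le (T.filter fun P => (f P : ℝ) ≤ R) f {0} (fun _ => A) (fun _ => R)
      (fun _ _ => hR0) (fun P hP => ?_)
    · simpa using this
    · rw [Finset.mem_filter] at hP
      exact ⟨0, by simp, hA P hP.1, hf P hP.1, hP.2⟩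
  have hD : (0 : ℝ) ≤ (D : ℝ) ^ 11 := by positivity
  have c1 : ((T.filter fun P => ((P.x₂ * P.q : ℕ) : ℝ) ≤ R).card : ℝ) ≤ R * D ^ 11 := by
    have h1 := (hT.subset (T.filter_subset fun P => ((P.x₂ * P.q : ℕ) : ℝ) ≤ R)).card_le_of_den₁_x₂_q
    have h2 := aux (fun P => P.x₂ * P.q)
      fun P hP => Nat.mul_pos (hT.valid P hP).x₂_pos (hT.valid P hP).q_pos
    exact (show ((T.filter fun P => ((P.x₂ * P.q : ℕ) : ℝ) ≤ R).card : ℝ) ≤ _ by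
      exact_mod_cast h1).trans (mul_le_mul_of_nonneg_right h2 hD)
  have c2 : ((T.filter fun P => ((P.y₂ * P.q : ℕ) : ℝ) ≤ R).card : ℝ) ≤ R * D ^ 11 := by
    have h1 := (hT.subset (T.filter_subset fun P => ((P.y₂ * P.q : ℕ) : ℝ) ≤ R)).card_le_of_den₁_y₂_q
    have h2 := aux (fun P => P.y₂ * P.q)
      fun P hP => Nat.mul_pos (hT.valid P hP).y₂_pos (hT.valid P hP).q_pos
    exact (show ((T.filter fun P => ((P.y₂ * P.q : ℕ) : ℝ) ≤ R).card : ℝ) ≤ _ by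
      exact_mod_cast h1).trans (mul_le_mul_of_nonneg_right h2 hD)
  have c3 : ((T.filter fun P => ((P.x₂ * P.y₂ : ℕ) : ℝ) ≤ R).card : ℝ) ≤ R * D ^ 11 := by
    have h1 := (hT.subset (T.filter_subset fun P => ((P.x₂ * P.y₂ : ℕ) : ℝ) ≤ R)).card_le_of_den₁_x₂_y₂
    have h2 := aux (fun P => P.x₂ * P.y₂)
      fun P hP => Nat.mul_pos (hT.valid P hP).x₂_pos (hT.valid P hP).y₂_pos
    exact (show ((T.filter fun P => ((P.x₂ * P.y₂ : ℕ) : ℝ) ≤ R).card : ℝ) ≤ _ by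
      exact_mod_cast h1).trans (mul_le_mul_of_nonneg_right h2 hD)
  -- The three products multiply to (x₂ y₂ q)² ≤ V² = R³, so they cannot all exceed R.
  have hcover : T ⊆ (T.filter fun P => ((P.x₂ * P.q : ℕ) : ℝ) ≤ R) ∪
      (T.filter fun P => ((P.y₂ * P.q : ℕ) : ℝ) ≤ R) ∪
      (T.filter fun P => ((P.x₂ * P.y₂ : ℕ) : ℝ) ≤ R) := by
    intro P hP
    by_contra hcon
    simp only [Finset.mem_union, Finset.mem_filter, hP, true_and, not_or, not_le] at hcon
    obtain ⟨⟨h1, h2⟩, h3⟩ := hcon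
    have h4 : R ^ 3 < ((P.x₂ * P.q : ℕ) : ℝ) * ((P.y₂ * P.q : ℕ) : ℝ) * ((P.x₂ * P.y₂ : ℕ) : ℝ) := by
      calc R ^ 3 = R * R * R := by ring
        _ ≤ ((P.x₂ * P.q : ℕ) : ℝ) * ((P.y₂ * P.q : ℕ) : ℝ) * R := by gcongr
        _ < _ := by
          have : 0 < ((P.x₂ * P.q : ℕ) : ℝ) * ((P.y₂ * P.q : ℕ) : ℝ) :=
            mul_pos (hR0.trans_lt h1) (hR0.trans_lt h2)
          gcongr
    have h5 : ((P.x₂ * P.q : ℕ) : ℝ) * ((P.y₂ * P.q : ℕ) : ℝ) * ((P.x₂ * P.y₂ : ℕ) : ℝ) =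
        ((P.x₂ * P.y₂ * P.q : ℕ) : ℝ) ^ 2 := by push_cast; ring
    have h6 : ((P.x₂ * P.y₂ * P.q : ℕ) : ℝ) ≤ V := by
      refine le_trans ?_ (hden P hP)
      have hv := hT.valid P hP
      exact_mod_cast Nat.le_mul_of_pos_left _ (Nat.mul_pos hv.n₂_pos hv.g_pos)
    have h7 : ((P.x₂ * P.y₂ * P.q : ℕ) : ℝ) ^ 2 ≤ V ^ 2 := by gcongr
    linarith
  have h1 := (Finset.card_le_card hcover).trans
    ((Finset.card_union_le _ _).trans (Nat.add_le_add_right (Finset.card_union_le _ _) _))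
  have h2 : (T.card : ℝ) ≤ (T.filter fun P => ((P.x₂ * P.q : ℕ) : ℝ) ≤ R).card +
      (T.filter fun P => ((P.y₂ * P.q : ℕ) : ℝ) ≤ R).card +
      (T.filter fun P => ((P.x₂ * P.y₂ : ℕ) : ℝ) ≤ R).card := by exact_mod_cast h1
  linarith

end FourParam

namespace FourParam

variable {m n Y D : ℕ} {T : Finset FourParam}

/-- The right side is exactly n₂ c₁ times the left. Small second and third denominators with a large
x₂ q thus force the product counted in `card_le_of_product` to be small. -/
theorem IsValid.product_mul_le {P : FourParam} (V : P.IsValid m n) :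
    P.g * (P.x₁ * P.p * P.z) * P.y₂ * (P.x₂ * P.q) ^ 2 ≤ P.den₂ * P.den₃ := by
  calc P.g * (P.x₁ * P.p * P.z) * P.y₂ * (P.x₂ * P.q) ^ 2
      ≤ (P.n₂ * P.c₁) * (P.g * (P.x₁ * P.p * P.z) * P.y₂ * (P.x₂ * P.q) ^ 2) :=
        Nat.le_mul_of_pos_left _ (Nat.mul_pos V.n₂_pos V.c₁_pos)
    _ = _ := by unfold den₂ den₃; ring

/-- Counting solutions whose first denominator is not the smallest possible one. -/
theorem IsFamily.card_le_of_index_pos (hT : IsFamily m n Y D T) (hS : ∀ P ∈ T, P.IsOrdered m n)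
    (hne : ∀ P ∈ T, P.den₁ ≠ n / m + 1) (w : ℝ) (hw : 0 < w) (hw2 : w ^ 2 = n / m) :
    (T.card : ℝ) ≤ (w ^ 3 * (28 * ∑ j ∈ Finset.Icc 1 (4 * n / m), 1 / (j : ℝ) + 3) +
      4 * w ^ 2) * D ^ 11 := by
  set J := Finset.Icc 1 (4 * n / m) with hJ
  have hm := hT.m_pos
  have hn := hT.n_pos
  have hm' : (0 : ℝ) < m := by exact_mod_cast hm
  have hn' : (0 : ℝ) < n := by exact_mod_cast hn
  have hidx : ∀ P ∈ T, ∃ j ∈ J, P.den₁ = n / m + 1 + j ∧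
      (m : ℝ) * j + 1 ≤ m * P.den₁ - n := by
    intro P hP
    obtain ⟨j, h1, h2, h3⟩ := (hS P hP).first (hT.valid P hP) hn hm
    refine ⟨j, Finset.mem_Icc.mpr ⟨?_, h1⟩, h2, h3⟩
    refine Nat.pos_of_ne_zero ?_
    rintro rfl
    exact hne P hP h2
  choose! j hjJ hj hju using hidx
  have hj0 : ∀ P ∈ T, (0 : ℝ) < j P := fun P hP => by
    exact_mod_cast (Finset.mem_Icc.mp (hjJ P hP)).1
  -- the approximate position of the second denominator
  have hl : ∀ P ∈ T, (P.den₁ : ℝ) * n / (m * P.den₁ - n) ≤ 4 * w ^ 4 / j P := by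
    intro P hP
    have hu := hju P hP
    have hj0' := hj0 P hP
    obtain ⟨-, h2, -⟩ := (hS P hP).second (hT.valid P hP) hn
    have h3 : (P.den₁ : ℝ) ≤ 4 * n / m := by rw [le_div_iff₀ hm']; linarith
    calc (P.den₁ : ℝ) * n / (m * P.den₁ - n) ≤ 4 * n / m * n / (m * j P) := by
          gcongr
          linarith
      _ = 4 * (n / m) ^ 2 / j P := by field_simp
      _ = _ := by rw [← hw2]; ring
  have hD : (0 : ℝ) ≤ (D : ℝ) ^ 11 := by positivity
  set H := ∑ j ∈ J, 1 / (j : ℝ) with hH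
  -- The thresholds w³/j and w⁵/j balance the three cases: each contributes w³ up to the harmonic
  -- sum and lower-order terms.
  set SA := T.filter fun P => ((P.x₂ * P.q : ℕ) : ℝ) ≤ 4 * w ^ 3 / j P with hSA
  set SB := T.filter fun P => 4 * w ^ 5 / j P ≤ (P.den₃ : ℝ) with hSB
  set SC := T.filter fun P => 4 * w ^ 3 / j P < ((P.x₂ * P.q : ℕ) : ℝ) ∧
    (P.den₃ : ℝ) < 4 * w ^ 5 / j P with hSC
  have cA : (SA.card : ℝ) ≤ 4 * w ^ 3 * H * D ^ 11 := by
    have h1 := (hT.subset (Finset.filter_subset _ T : SA ⊆ T)).card_le_of_den₁_x₂_q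
    have h2 := card_image_den₁_le SA (fun P => P.x₂ * P.q) J (fun j => n / m + 1 + j)
      (fun j => 4 * w ^ 3 / j) (fun j _ => by positivity) (fun P hP => by
        obtain ⟨hPT, hPA⟩ := Finset.mem_filter.mp hP
        exact ⟨j P, hjJ P hPT, hj P hPT,
          Nat.mul_pos (hT.valid P hPT).x₂_pos (hT.valid P hPT).q_pos, hPA⟩)
    have h3 : ∑ j ∈ J, 4 * w ^ 3 / (j : ℝ) = 4 * w ^ 3 * H := by
      rw [hH, Finset.mul_sum]
      exact Finset.sum_congr rfl fun j _ => by ring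
    rw [h3] at h2
    exact (show (SA.card : ℝ) ≤ _ by exact_mod_cast h1).trans (mul_le_mul_of_nonneg_right h2 hD)
  have cB : (SB.card : ℝ) ≤ (24 * w ^ 3 * H + 4 * w ^ 2) * D ^ 11 := by
    have h1 := (hT.subset (Finset.filter_subset _ T : SB ⊆ T)).card_le_of_den₁_den₂
    have h2 : ((SB.image fun P => (P.den₁, P.den₂)).card : ℝ) ≤ 24 * w ^ 3 * H + 4 * w ^ 2 := by
      set a : ℕ → ℕ := fun j => n / m + 1 + j with ha
      set l : ℕ → ℝ := fun j => (a j : ℝ) * n / (m * (a j : ℕ) - n) with hldef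
      -- The second denominator lies in (l, l + 24w³/j]. Rounding costs one extra integer per j,
      -- which produces the term 4w².
      set B : ℕ → Finset (ℕ × ℕ) := fun j =>
        {a j} ×ˢ Finset.Ioc ⌊l j⌋₊ ⌊l j + 24 * w ^ 3 / j⌋₊ with hB
      have hsub : (SB.image fun P => (P.den₁, P.den₂)) ⊆ J.biUnion B := by
        intro x hx
        obtain ⟨P, hP, rfl⟩ := Finset.mem_image.mp hx
        obtain ⟨hPT, hPB⟩ := Finset.mem_filter.mp hP
        have hj0' := hj0 P hPT
        obtain ⟨k1, -, k3, -, k5⟩ := (hS P hPT).second (hT.valid P hPT) hn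
        have hll := hl P hPT
        have ha' : P.den₁ = a (j P) := hj P hPT
        have hl0 : 0 ≤ (P.den₁ : ℝ) * n / (m * P.den₁ - n) := by positivity
        have hc0 : (0 : ℝ) < P.den₃ := lt_of_lt_of_le (by positivity) hPB
        have k6 : 6 * ((P.den₁ : ℝ) * n / (m * P.den₁ - n)) ^ 2 / P.den₃ ≤ 24 * w ^ 3 / j P := by
          calc 6 * ((P.den₁ : ℝ) * n / (m * P.den₁ - n)) ^ 2 / P.den₃
              ≤ 6 * (4 * w ^ 4 / j P) ^ 2 / (4 * w ^ 5 / j P) := by gcongr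
            _ = _ := by field_simp; ring
        have hlj : l (j P) = (P.den₁ : ℝ) * n / (m * P.den₁ - n) := by
          simp only [hldef, ← ha']
        simp only [Finset.mem_biUnion, hB, Finset.mem_product, Finset.mem_singleton,
          Finset.mem_Ioc]
        refine ⟨j P, hjJ P hPT, ha', ?_, ?_⟩
        · rw [hlj]
          exact (Nat.floor_lt hl0).mpr k3
        · refine Nat.le_floor ?_
          rw [hlj]
          linarith
      have hcard : ∀ j ∈ J, ((B j).card : ℝ) ≤ 24 * w ^ 3 / j + 1 := by
        intro j hj
        have hj1 : 1 ≤ j := (Finset.mem_Icc.mp hj).1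
        have hj0' : (0 : ℝ) < j := by exact_mod_cast hj1
        have hpos : 0 ≤ 24 * w ^ 3 / (j : ℝ) := by positivity
        have hl0 : 0 ≤ l j := by
          have h3 := Nat.lt_mul_div_succ n hm
          have h4 : n ≤ m * a j := by
            calc n ≤ m * (n / m + 1) := h3.le
              _ ≤ _ := Nat.mul_le_mul_left _ (Nat.le_add_right _ _)
          have h5 : (0 : ℝ) ≤ m * (a j : ℕ) - n := by
            have : (n : ℝ) ≤ m * (a j : ℕ) := by exact_mod_cast h4
            linarith
          exact div_nonneg (by positivity) h5
        have e : (B j).card = ⌊l j + 24 * w ^ 3 / j⌋₊ - ⌊l j⌋₊ := by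
          simp [hB]
        have hle : ⌊l j⌋₊ ≤ ⌊l j + 24 * w ^ 3 / j⌋₊ := Nat.floor_mono (by linarith)
        rw [e, Nat.cast_sub hle]
        have f1 := Nat.floor_le (show 0 ≤ l j + 24 * w ^ 3 / j by positivity)
        have f2 := Nat.lt_floor_add_one (l j)
        linarith
      calc ((SB.image fun P => (P.den₁, P.den₂)).card : ℝ)
          ≤ ((∑ j ∈ J, (B j).card : ℕ) : ℝ) := by
            exact_mod_cast (Finset.card_le_card hsub).trans Finset.card_biUnion_le
        _ = ∑ j ∈ J, ((B j).card : ℝ) := by push_cast; rfl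
        _ ≤ ∑ j ∈ J, (24 * w ^ 3 / (j : ℝ) + 1) := Finset.sum_le_sum hcard
        _ = 24 * w ^ 3 * H + (4 * n / m : ℕ) := by
            rw [Finset.sum_add_distrib, hH, Finset.mul_sum]
            congr 1
            · exact Finset.sum_congr rfl fun j _ => by ring
            · simp [hJ]
        _ ≤ 24 * w ^ 3 * H + 4 * w ^ 2 := by
            gcongr
            calc ((4 * n / m : ℕ) : ℝ) ≤ ((4 * n : ℕ) : ℝ) / m := Nat.cast_div_le
              _ = 4 * w ^ 2 := by rw [hw2]; push_cast; ring
    exact (show (SB.card : ℝ) ≤ _ by exact_mod_cast h1).trans (mul_le_mul_of_nonneg_right h2 hD)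
  have cC : (SC.card : ℝ) ≤ 3 * w ^ 3 * D ^ 11 := by
    have h1 := (hT.subset (Finset.filter_subset _ T : SC ⊆ T)).card_le_of_product
    have h2 : ((SC.image fun P => P.g * (P.x₁ * P.p * P.z) * P.y₂).card : ℝ) ≤ 3 * w ^ 3 := by
      have hsub : (SC.image fun P => P.g * (P.x₁ * P.p * P.z) * P.y₂) ⊆
          Finset.Icc 1 ⌊3 * w ^ 3⌋₊ := by
        intro x hx
        obtain ⟨P, hP, rfl⟩ := Finset.mem_image.mp hx
        obtain ⟨hPT, hP1, hP2⟩ := Finset.mem_filter.mp hP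
        have V := hT.valid P hPT
        have hj0' := hj0 P hPT
        obtain ⟨-, -, -, k4, -⟩ := (hS P hPT).second V hn
        have hll := hl P hPT
        refine Finset.mem_Icc.mpr ⟨?_, Nat.le_floor ?_⟩
        · exact Nat.mul_pos (Nat.mul_pos V.g_pos
            (Nat.mul_pos (Nat.mul_pos V.x₁_pos V.p_pos) V.z_pos)) V.y₂_pos
        · have h3 : ((P.g * (P.x₁ * P.p * P.z) * P.y₂ : ℕ) : ℝ) * ((P.x₂ * P.q : ℕ) : ℝ) ^ 2 ≤
              P.den₂ * P.den₃ := by exact_mod_cast V.product_mul_le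
          have h4 : ((P.g * (P.x₁ * P.p * P.z) * P.y₂ : ℕ) : ℝ) * (4 * w ^ 3 / j P) ^ 2 ≤
              (3 * (4 * w ^ 4 / j P)) * (4 * w ^ 5 / j P) := by
            calc ((P.g * (P.x₁ * P.p * P.z) * P.y₂ : ℕ) : ℝ) * (4 * w ^ 3 / j P) ^ 2
                ≤ ((P.g * (P.x₁ * P.p * P.z) * P.y₂ : ℕ) : ℝ) * ((P.x₂ * P.q : ℕ) : ℝ) ^ 2 := by
                  gcongr
              _ ≤ (P.den₂ : ℝ) * P.den₃ := h3
              _ ≤ _ := by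
                gcongr
                linarith
          -- The powers of j cancel, so this case needs no sum over the first denominator.
          have h5 : (3 * (4 * w ^ 4 / j P)) * (4 * w ^ 5 / j P) =
              (3 * w ^ 3) * (4 * w ^ 3 / j P) ^ 2 := by field_simp
          rw [h5] at h4
          exact le_of_mul_le_mul_right h4 (by positivity)
      calc ((SC.image fun P => P.g * (P.x₁ * P.p * P.z) * P.y₂).card : ℝ)
          ≤ ((Finset.Icc 1 ⌊3 * w ^ 3⌋₊).card : ℝ) := by exact_mod_cast Finset.card_le_card hsub
        _ = (⌊3 * w ^ 3⌋₊ : ℝ) := by simp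
        _ ≤ _ := Nat.floor_le (by positivity)
    exact (show (SC.card : ℝ) ≤ _ by exact_mod_cast h1).trans (mul_le_mul_of_nonneg_right h2 hD)
  have hcover : T ⊆ SA ∪ SB ∪ SC := by
    intro P hP
    simp only [Finset.mem_union, hSA, hSB, hSC, Finset.mem_filter, hP, true_and]
    by_contra hcon
    push Not at hcon
    obtain ⟨⟨h1, h2⟩, h3⟩ := hcon
    linarith [h3 h1]
  have h1 := (Finset.card_le_card hcover).trans
    ((Finset.card_union_le _ _).trans (Nat.add_le_add_right (Finset.card_union_le _ _) _))
  have h2 : (T.card : ℝ) ≤ SA.card + SB.card + SC.card := by exact_mod_cast h1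
  calc (T.card : ℝ) ≤ _ := h2
    _ ≤ 4 * w ^ 3 * H * D ^ 11 + (24 * w ^ 3 * H + 4 * w ^ 2) * D ^ 11 + 3 * w ^ 3 * D ^ 11 := by
        linarith
    _ = _ := by ring

end FourParam

open FourParam in
/-- Bound for the number of representations as a sum of four unit fractions. -/
theorem exists_unitFractionCount_four_le (ε : ℝ) (hε : 0 < ε) :
    ∃ C : ℝ, 0 < C ∧ ∀ m n : ℕ, 0 < m → 0 < n → (unitFractionCount 4 m n : ℝ) ≤
      C * (n : ℝ) ^ ε * (((n : ℝ) / m) ^ ((3 : ℝ) / 2) + ((n : ℝ) ^ 2 / m) ^ ((2 : ℝ) / 3)) := by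
  -- Here 5280 = 2 · 8 · 30 · 11: eleven divisors, numbers up to Y^30, and Y of order n^8 cost
  -- n^(ε/2) in total. The harmonic sum takes the other half.
  obtain ⟨C₁, hC₁, hdiv⟩ := exists_card_divisors_le_rpow (ε / 5280) (by positivity)
  set C₂ : ℝ := 39 + 56 * 4 ^ (ε / 2) / ε with hC₂
  have hC₂0 : 39 ≤ C₂ := by
    have : 0 ≤ 56 * (4 : ℝ) ^ (ε / 2) / ε := by positivity
    linarith
  refine ⟨C₁ ^ 11 * 4608 ^ (ε / 16) * C₂, by positivity, fun m n hm hn => ?_⟩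
  have hm' : (0 : ℝ) < m := by exact_mod_cast hm
  have hn' : (1 : ℝ) ≤ n := by exact_mod_cast hn
  have hn0 : (0 : ℝ) < n := by linarith
  obtain ⟨T, hcard, hT⟩ := exists_finset m n hn
  rw [← hcard]
  rcases T.eq_empty_or_nonempty with rfl | ⟨P₀, hP₀⟩
  · simp only [Finset.card_empty, Nat.cast_zero]
    positivity
  have hsize : ∀ P ∈ T, m ≤ 4 * n ∧ P.den₁ ≤ 4 * n ∧ P.den₂ ≤ 12 * n ^ 2 ∧
      P.den₃ ≤ 96 * n ^ 4 ∧ P.den₄ ≤ 4608 * n ^ 8 := by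
    intro P hP
    obtain ⟨V, h1, h2, h3, h4⟩ := hT P hP
    exact four_unit_fractions_le hn hm V.den₁_pos h1 h2 h3 h4
  have hm4 : m ≤ 4 * n := (hsize P₀ hP₀).1
  set Y : ℕ := 4608 * n ^ 8 with hY
  have hnY : ∀ k ≤ 8, n ^ k ≤ n ^ 8 := fun k hk => Nat.pow_le_pow_right hn hk
  have hn1 := hnY 1 (by norm_num)
  have hn2 := hnY 2 (by norm_num)
  have hn4 := hnY 4 (by norm_num)
  rw [pow_one] at hn1
  set D : ℕ := ⌊C₁ * ((Y : ℝ) ^ 30) ^ (ε / 5280)⌋₊ with hD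
  have fam : IsFamily m n Y D T :=
    { m_pos := hm
      n_pos := hn
      two_le := by omega
      m_le := by simp only [PowBounded, zero_add, pow_one]; omega
      n_le := by simp only [PowBounded, zero_add, pow_one]; omega
      card_le := fun N hN hNY => by
        refine Nat.le_floor ((hdiv N hN).trans ?_)
        have : (N : ℝ) ≤ (Y : ℝ) ^ 30 := by exact_mod_cast hNY
        gcongr
      valid := fun P hP => (hT P hP).1
      bounded := fun P hP => by
        obtain ⟨-, h1, h2, h3, h4⟩ := hsize P hP
        refine (hT P hP).1.isBounded hn (by omega) ?_ (by omega) (by omega) (by omega)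
        calc n * P.den₁ ≤ n * (4 * n) := Nat.mul_le_mul_left n h1
          _ = 4 * n ^ 2 := by ring
          _ ≤ Y := by omega }
  have hord : ∀ P ∈ T, P.IsOrdered m n := fun P hP => (hT P hP).2
  have hDle : (D : ℝ) ^ 11 ≤ C₁ ^ 11 * 4608 ^ (ε / 16) * (n : ℝ) ^ (ε / 2) := by
    have h1 : (D : ℝ) ≤ C₁ * ((Y : ℝ) ^ 30) ^ (ε / 5280) := Nat.floor_le (by positivity)
    have hY0 : (0 : ℝ) ≤ Y := Nat.cast_nonneg _
    calc (D : ℝ) ^ 11 ≤ (C₁ * ((Y : ℝ) ^ 30) ^ (ε / 5280)) ^ 11 := by gcongr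
      _ = C₁ ^ 11 * (Y : ℝ) ^ (ε / 16) := by
          have e : (((Y : ℝ) ^ 30) ^ (ε / 5280)) ^ 11 = (Y : ℝ) ^ (ε / 16) := by
            rw [← Real.rpow_natCast _ 11, ← Real.rpow_natCast _ 30, ← Real.rpow_mul hY0,
              ← Real.rpow_mul hY0]
            congr 1
            push_cast
            ring
          rw [mul_pow, e]
      _ = C₁ ^ 11 * 4608 ^ (ε / 16) * (n : ℝ) ^ (ε / 2) := by
          rw [hY]
          push_cast
          rw [Real.mul_rpow (by norm_num) (by positivity), ← Real.rpow_natCast (n : ℝ),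
            ← Real.rpow_mul hn0.le, mul_assoc]
          congr 3
          push_cast
          ring
  set w : ℝ := Real.sqrt (n / m) with hw
  have hw0 : 0 < w := Real.sqrt_pos.mpr (by positivity)
  have hw2 : w ^ 2 = n / m := Real.sq_sqrt (by positivity)
  have hw3 : w ^ 3 = ((n : ℝ) / m) ^ ((3 : ℝ) / 2) := by
    rw [← hw2, ← Real.rpow_natCast w 2, ← Real.rpow_mul hw0.le, ← Real.rpow_natCast]
    norm_num
  have hwhalf : 1 ≤ 2 * w := by
    have h1 : (1 : ℝ) ≤ 4 * w ^ 2 := by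
      rw [hw2, mul_div_assoc', le_div_iff₀ hm', one_mul]
      exact_mod_cast hm4
    nlinarith
  set H := ∑ j ∈ Finset.Icc 1 (4 * n / m), 1 / (j : ℝ) with hH
  have hHle : 28 * H + 11 ≤ C₂ * (n : ℝ) ^ (ε / 2) := by
    have h1 : H ≤ 1 + (4 * n : ℝ) ^ (ε / 2) / (ε / 2) := by
      have e1 : H = (harmonic (4 * n / m) : ℝ) := by
        rw [hH, harmonic_eq_sum_Icc]
        push_cast
        simp
      rw [e1]
      have e2 : Real.log ((4 * n / m : ℕ) : ℝ) ≤ Real.log (4 * n : ℝ) := by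
        rcases Nat.eq_zero_or_pos (4 * n / m) with h0 | h0
        · rw [h0]
          simp only [Nat.cast_zero, Real.log_zero]
          exact Real.log_nonneg (by linarith)
        · refine Real.log_le_log (by exact_mod_cast h0) ?_
          exact_mod_cast Nat.div_le_self (4 * n) m
      have e3 := Real.log_le_rpow_div (show (0 : ℝ) ≤ 4 * n by positivity)
        (show 0 < ε / 2 by positivity)
      have e4 := harmonic_le_one_add_log (4 * n / m)
      linarith
    have h2 : (1 : ℝ) ≤ (n : ℝ) ^ (ε / 2) := Real.one_le_rpow hn' (by positivity)
    rw [Real.mul_rpow (by norm_num) hn0.le] at h1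
    calc 28 * H + 11 ≤ 28 * (1 + (4 : ℝ) ^ (ε / 2) * (n : ℝ) ^ (ε / 2) / (ε / 2)) + 11 := by linarith
      _ = 39 + 56 * 4 ^ (ε / 2) / ε * (n : ℝ) ^ (ε / 2) := by field_simp; ring
      _ ≤ _ := by rw [hC₂]; nlinarith
  have c0 : ((T.filter fun P => P.den₁ = n / m + 1).card : ℝ) ≤
      3 * (12 * ((n : ℝ) ^ 2 / m)) ^ ((2 : ℝ) / 3) * D ^ 11 := by
    refine (fam.subset (Finset.filter_subset _ T)).card_le_of_den₁ (n / m + 1) _ (by positivity)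
      (fun P hP => (Finset.mem_filter.mp hP).2) fun P hP => ?_
    have hPT := (Finset.mem_filter.mp hP).1
    obtain ⟨-, h2, -, h4, -⟩ := (hord P hPT).second (hT P hPT).1 hn
    obtain ⟨j, -, -, hj⟩ := (hord P hPT).first (hT P hPT).1 hn hm
    have h5 : (P.den₁ : ℝ) ≤ 4 * n / m := by rw [le_div_iff₀ hm']; linarith
    have h6 : (1 : ℝ) ≤ m * P.den₁ - n := by
      have : (0 : ℝ) ≤ m * j := by positivity
      linarith
    calc (P.den₂ : ℝ) ≤ 3 * (P.den₁ * n / (m * P.den₁ - n)) := h4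
      _ ≤ 3 * (4 * n / m * n / 1) := by gcongr
      _ = _ := by ring
  have c1 := (fam.subset (Finset.filter_subset (fun P => ¬ P.den₁ = n / m + 1) T)).card_le_of_index_pos
    (fun P hP => hord P (Finset.mem_filter.mp hP).1) (fun P hP => (Finset.mem_filter.mp hP).2)
    w hw0 hw2
  have hsum : (T.card : ℝ) = (T.filter fun P => P.den₁ = n / m + 1).card +
      (T.filter fun P => ¬ P.den₁ = n / m + 1).card := by
    exact_mod_cast (Finset.card_filter_add_card_filter_not (s := T) fun P => P.den₁ = n / m + 1).symm
  have h12 : (12 : ℝ) ^ ((2 : ℝ) / 3) ≤ 12 := by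
    calc (12 : ℝ) ^ ((2 : ℝ) / 3) ≤ 12 ^ (1 : ℝ) :=
          Real.rpow_le_rpow_of_exponent_le (by norm_num) (by norm_num)
      _ = 12 := Real.rpow_one _
  have hne1 : (1 : ℝ) ≤ (n : ℝ) ^ (ε / 2) := Real.one_le_rpow hn' (by positivity)
  set Q := ((n : ℝ) ^ 2 / m) ^ ((2 : ℝ) / 3) with hQ
  have hQ0 : 0 ≤ Q := by positivity
  have hsplit : (12 * ((n : ℝ) ^ 2 / m)) ^ ((2 : ℝ) / 3) = 12 ^ ((2 : ℝ) / 3) * Q :=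
    Real.mul_rpow (by norm_num) (by positivity)
  rw [hsplit] at c0
  rw [← hw3]
  have hw30 : 0 ≤ w ^ 3 := by positivity
  have step1 : (T.card : ℝ) ≤ (w ^ 3 * (28 * H + 11) + 36 * Q) * D ^ 11 := by
    -- The inequality w ≥ 1/2 holds because a solution forces m ≤ 4n.
    have e1 : 4 * w ^ 2 ≤ 8 * w ^ 3 := by nlinarith [sq_nonneg w]
    have e2 : 3 * ((12 : ℝ) ^ ((2 : ℝ) / 3) * Q) ≤ 36 * Q := by nlinarith
    calc (T.card : ℝ) ≤ 3 * ((12 : ℝ) ^ ((2 : ℝ) / 3) * Q) * D ^ 11 +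
          (w ^ 3 * (28 * H + 3) + 4 * w ^ 2) * D ^ 11 := by rw [hsum]; exact add_le_add c0 c1
      _ = (w ^ 3 * (28 * H + 3) + 4 * w ^ 2 + 3 * ((12 : ℝ) ^ ((2 : ℝ) / 3) * Q)) * D ^ 11 := by
          ring
      _ ≤ _ := by
          gcongr
          linarith
  have step2 : w ^ 3 * (28 * H + 11) + 36 * Q ≤ C₂ * (n : ℝ) ^ (ε / 2) * (w ^ 3 + Q) := by
    have e1 := mul_le_mul_of_nonneg_left hHle hw30
    have e2 : 36 * Q ≤ C₂ * (n : ℝ) ^ (ε / 2) * Q := by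
      gcongr
      nlinarith
    linarith
  calc (T.card : ℝ) ≤ (w ^ 3 * (28 * H + 11) + 36 * Q) * D ^ 11 := step1
    _ ≤ (C₂ * (n : ℝ) ^ (ε / 2) * (w ^ 3 + Q)) *
        (C₁ ^ 11 * 4608 ^ (ε / 16) * (n : ℝ) ^ (ε / 2)) := by gcongr
    _ = C₁ ^ 11 * 4608 ^ (ε / 16) * C₂ * ((n : ℝ) ^ (ε / 2) * (n : ℝ) ^ (ε / 2)) * (w ^ 3 + Q) := by
        ring
    _ = _ := by
        rw [← Real.rpow_add hn0, add_halves]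

/-! ### Recursion on the number of fractions, and five fractions -/

/-- Splitting off the smallest denominator. -/
theorem unitFractionCount_succ_le (k m n : ℕ) (hk : 1 ≤ k) (hm : 0 < m) (hn : 0 < n) :
    unitFractionCount (k + 1) m n ≤
      ∑ a ∈ (Finset.Icc 1 ((k + 1) * n / m)).filter (fun a => n < m * a),
        unitFractionCount k (m * a - n) (a * n) := by
  have hcount : ∀ k m n, unitFractionCount k m n = (unitFractionReps_finite k m n).toFinset.card :=
    fun k m n => Set.ncard_eq_toFinset_card _ _
  simp only [hcount]
  have hsub : (unitFractionReps_finite (k + 1) m n).toFinset ⊆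
      ((Finset.Icc 1 ((k + 1) * n / m)).filter (fun a => n < m * a)).biUnion fun a =>
        (unitFractionReps_finite k (m * a - n) (a * n)).toFinset.image
          (fun t : Fin k → ℕ => (Fin.cons a t : Fin (k + 1) → ℕ)) := by
    intro a ha
    rw [Set.Finite.mem_toFinset] at ha
    obtain ⟨hpos, hmono, hsum⟩ := ha
    have h0 : (0 : ℚ) < a 0 := by exact_mod_cast hpos 0
    have hn' : (0 : ℚ) < n := by exact_mod_cast hn
    have hle : m * a 0 ≤ (k + 1) * n := by
      have h1 : ∑ i, 1 / (a i : ℚ) ≤ ∑ _i : Fin (k + 1), 1 / (a 0 : ℚ) := by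
        refine Finset.sum_le_sum (fun i _ => ?_)
        exact one_div_le_one_div_of_le h0 (by exact_mod_cast hmono (Fin.zero_le i))
      rw [← hsum, Finset.sum_const, Finset.card_univ, Fintype.card_fin, nsmul_eq_mul,
        mul_one_div, div_le_div_iff₀ hn' h0] at h1
      exact_mod_cast h1
    rw [Fin.sum_univ_succ] at hsum
    have htail : (0 : ℚ) < ∑ i : Fin k, 1 / (a i.succ : ℚ) := by
      have : Nonempty (Fin k) := ⟨⟨0, hk⟩⟩
      refine Finset.sum_pos (fun i _ => ?_) Finset.univ_nonempty
      have : (0 : ℚ) < a i.succ := by exact_mod_cast hpos _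
      positivity
    have hlt : n < m * a 0 := by
      have h1 : (1 : ℚ) / a 0 < m / n := by linarith
      rw [div_lt_div_iff₀ h0 hn', one_mul] at h1
      exact_mod_cast h1
    simp only [Finset.mem_biUnion, Finset.mem_filter, Finset.mem_Icc, Finset.mem_image,
      Set.Finite.mem_toFinset]
    -- The tail is kept monotone but the condition that it starts at or above `a 0` is dropped,
    -- hence only an upper bound.
    refine ⟨a 0, ⟨⟨hpos 0, (Nat.le_div_iff_mul_le hm).mpr (by linarith)⟩, hlt⟩, Fin.tail a,
      ⟨fun i => hpos _, fun i j hij => hmono (Fin.succ_le_succ_iff.mpr hij), ?_⟩,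
      Fin.cons_self_tail a⟩
    have e : ((m * a 0 - n : ℕ) : ℚ) / ((a 0 * n : ℕ) : ℚ) = m / n - 1 / a 0 := by
      rw [Nat.cast_sub hlt.le]
      push_cast
      field_simp
    rw [e, hsum]
    simp [Fin.tail]
  refine (Finset.card_le_card hsub).trans (Finset.card_biUnion_le.trans ?_)
  exact Finset.sum_le_sum fun a _ => Finset.card_image_le

/-- With x < y the square roots of consecutive integers, 1/y³ ≤ 2/x - 2/y, and this telescopes. -/
theorem sum_rpow_neg_three_halves_le (J : ℕ) :
    ∑ i ∈ Finset.Icc 1 J, (i : ℝ) ^ (-(3 / 2) : ℝ) ≤ 3 := by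
  have key : ∀ J : ℕ, ∑ i ∈ Finset.Icc 1 (J + 1), (i : ℝ) ^ (-(3 / 2) : ℝ) ≤
      3 - 2 / Real.sqrt ((J : ℝ) + 1) := by
    intro J
    induction J with
    | zero => norm_num
    | succ J ih =>
      rw [Finset.sum_Icc_succ_top (by omega)]
      push_cast at ih ⊢
      set x := Real.sqrt ((J : ℝ) + 1) with hx
      set y := Real.sqrt ((J : ℝ) + 1 + 1) with hy
      have hx0 : 0 < x := Real.sqrt_pos.mpr (by positivity)
      have hy0 : 0 < y := Real.sqrt_pos.mpr (by positivity)
      have hx2 : x ^ 2 = (J : ℝ) + 1 := Real.sq_sqrt (by positivity)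
      have hy2 : y ^ 2 = (J : ℝ) + 1 + 1 := Real.sq_sqrt (by positivity)
      have hxy : x ≤ y := Real.sqrt_le_sqrt (by linarith)
      have e1 : ((J : ℝ) + 1 + 1) ^ (-(3 / 2) : ℝ) = 1 / y ^ 3 := by
        rw [← hy2, ← Real.rpow_natCast y 2, ← Real.rpow_mul hy0.le, one_div,
          ← Real.rpow_natCast y 3, ← Real.rpow_neg hy0.le]
        norm_num
      have e2 : 1 / y ^ 3 ≤ 2 / x - 2 / y := by
        have h1 : 2 / x - 2 / y = 2 / (x * y * (x + y)) := by
          have : (y - x) * (x + y) = 1 := by nlinarith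
          field_simp
          linarith
        rw [h1, div_le_div_iff₀ (by positivity) (by positivity)]
        have : x * y * (x + y) ≤ y * y * (y + y) := by gcongr
        nlinarith
      rw [e1]
      linarith
  rcases J with _ | J
  · norm_num
  · have : 0 ≤ 2 / Real.sqrt ((J : ℝ) + 1) := by positivity
    linarith [key J]

/-- With x < y the cube roots of consecutive integers, y³ - x³ = 1 gives 1/y² ≤ 3(y - x), and this
telescopes. -/
theorem sum_rpow_neg_two_thirds_le (J : ℕ) :
    ∑ i ∈ Finset.Icc 1 J, (i : ℝ) ^ (-(2 / 3) : ℝ) ≤ 3 * (J : ℝ) ^ ((1 : ℝ) / 3) := by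
  induction J with
  | zero => norm_num
  | succ J ih =>
    rw [Finset.sum_Icc_succ_top (by omega)]
    push_cast
    set x := (J : ℝ) ^ ((1 : ℝ) / 3) with hx
    set y := ((J : ℝ) + 1) ^ ((1 : ℝ) / 3) with hy
    have hJ : (0 : ℝ) ≤ J := Nat.cast_nonneg J
    have hx0 : 0 ≤ x := by positivity
    have hy0 : 0 < y := by positivity
    have hx3 : x ^ 3 = J := by
      rw [hx, ← Real.rpow_natCast, ← Real.rpow_mul hJ]
      norm_num
    have hy3 : y ^ 3 = (J : ℝ) + 1 := by
      rw [hy, ← Real.rpow_natCast, ← Real.rpow_mul (by positivity)]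
      norm_num
    have hxy : x ≤ y := Real.rpow_le_rpow hJ (by linarith) (by norm_num)
    have e1 : ((J : ℝ) + 1) ^ (-(2 / 3) : ℝ) = 1 / y ^ 2 := by
      rw [one_div, hy, ← Real.rpow_natCast, ← Real.rpow_mul (by positivity),
        ← Real.rpow_neg (by positivity)]
      norm_num
    have e2 : 1 / y ^ 2 ≤ 3 * (y - x) := by
      rw [div_le_iff₀ (by positivity)]
      have h1 : (y - x) * (y ^ 2 + x * y + x ^ 2) = 1 := by nlinarith
      have h2 : y ^ 2 + x * y + x ^ 2 ≤ 3 * y ^ 2 := by nlinarith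
      nlinarith [mul_le_mul_of_nonneg_left h2 (sub_nonneg.mpr hxy)]
    rw [e1]
    linarith

theorem sum_le_sum_of_map {s t : Finset ℕ} (f : ℕ → ℕ) (F G : ℕ → ℝ)
    (hf : ∀ a ∈ s, f a ∈ t) (hinj : Set.InjOn f s) (hFG : ∀ a ∈ s, F a ≤ G (f a))
    (hG : ∀ i ∈ t, 0 ≤ G i) : ∑ a ∈ s, F a ≤ ∑ i ∈ t, G i := by
  calc ∑ a ∈ s, F a ≤ ∑ a ∈ s, G (f a) := Finset.sum_le_sum hFG
    _ = ∑ i ∈ s.image f, G i := (Finset.sum_image hinj).symm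
    _ ≤ _ := Finset.sum_le_sum_of_subset_of_nonneg
        (Finset.image_subset_iff.mpr hf) fun i hi _ => hG i hi

/-- Bound for the number of representations as a sum of five unit fractions. -/
theorem exists_unitFractionCount_five_le :
    ∃ C : ℝ, 0 < C ∧ ∀ m n : ℕ, 0 < m → 0 < n →
      (unitFractionCount 5 m n : ℝ) ≤ C * ((n : ℝ) ^ 2 / m) ^ ((8 : ℝ) / 5) := by
  -- The value 1/10 is the gap between 8/5 and the exponent 3/2 that the summation yields.
  obtain ⟨C, hC, hfour⟩ := exists_unitFractionCount_four_le (1 / 10) (by norm_num)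
  refine ⟨C * 5 ^ ((1 : ℝ) / 10) * (5 ^ ((3 : ℝ) / 2) * 3 +
    25 ^ ((2 : ℝ) / 3) * (3 * 5 ^ ((1 : ℝ) / 3))), by positivity, fun m n hm hn => ?_⟩
  have hm' : (1 : ℝ) ≤ m := by exact_mod_cast hm
  have hm0 : (0 : ℝ) < m := by linarith
  have hn0 : (0 : ℝ) < n := by exact_mod_cast hn
  set X : ℝ := (n : ℝ) ^ 2 / m with hX
  have hX0 : 0 < X := by positivity
  set J := 5 * n / m with hJ
  have hrec : (unitFractionCount 5 m n : ℝ) ≤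
      ∑ a ∈ (Finset.Icc 1 J).filter (fun a => n < m * a),
        (unitFractionCount 4 (m * a - n) (a * n) : ℝ) := by
    exact_mod_cast unitFractionCount_succ_le 4 m n (by norm_num) hm hn
  -- This is the four-fraction bound with a n replaced by 5X and m a - n by the index i = a - ⌊n/m⌋.
  set G : ℕ → ℝ := fun i => C * (5 * X) ^ ((1 : ℝ) / 10) *
    ((5 * X) ^ ((3 : ℝ) / 2) * (i : ℝ) ^ (-(3 / 2) : ℝ) +
      (25 * X ^ 2) ^ ((2 : ℝ) / 3) * (i : ℝ) ^ (-(2 / 3) : ℝ)) with hG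
  have hterm : ∀ a ∈ (Finset.Icc 1 J).filter (fun a => n < m * a),
      a - n / m ∈ Finset.Icc 1 J ∧ n / m < a ∧
      (unitFractionCount 4 (m * a - n) (a * n) : ℝ) ≤ G (a - n / m) := by
    intro a ha
    obtain ⟨haJ, hlt⟩ := Finset.mem_filter.mp ha
    obtain ⟨ha1, haJ⟩ := Finset.mem_Icc.mp haJ
    have hdiv := Nat.div_lt_of_lt_mul hlt
    obtain ⟨j, hj⟩ := Nat.exists_eq_add_of_lt hdiv
    have hi : a - n / m = j + 1 := by rw [hj, add_assoc, Nat.add_sub_cancel_left]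
    refine ⟨Finset.mem_Icc.mpr ⟨by omega, (Nat.sub_le _ _).trans haJ⟩, hdiv, ?_⟩
    rw [hi]
    have hu : j + 1 ≤ m * a - n := by
      have h1 := Nat.lt_mul_div_succ n hm
      have h2 : m * a = m * (n / m + 1) + m * j := by rw [hj]; ring
      have h3 : j ≤ m * j := Nat.le_mul_of_pos_left j hm
      omega
    have hN : ((a * n : ℕ) : ℝ) ≤ 5 * X := by
      have h1 : m * a ≤ 5 * n := by
        have := (Nat.le_div_iff_mul_le hm).mp haJ
        linarith
      have h2 : (m : ℝ) * a ≤ 5 * n := by exact_mod_cast h1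
      rw [hX, mul_div_assoc', le_div_iff₀ hm0]
      push_cast
      nlinarith
    have hu' : ((j + 1 : ℕ) : ℝ) ≤ ((m * a - n : ℕ) : ℝ) := by exact_mod_cast hu
    have hj0 : (0 : ℝ) < ((j + 1 : ℕ) : ℝ) := by positivity
    refine (hfour (m * a - n) (a * n) (by omega) (Nat.mul_pos ha1 hn)).trans ?_
    have e1 : (5 * X) ^ ((3 : ℝ) / 2) * ((j + 1 : ℕ) : ℝ) ^ (-(3 / 2) : ℝ) =
        (5 * X / ((j + 1 : ℕ) : ℝ)) ^ ((3 : ℝ) / 2) := by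
      rw [Real.div_rpow (by positivity) hj0.le, Real.rpow_neg hj0.le, ← div_eq_mul_inv]
    have e2 : (25 * X ^ 2) ^ ((2 : ℝ) / 3) * ((j + 1 : ℕ) : ℝ) ^ (-(2 / 3) : ℝ) =
        ((5 * X) ^ 2 / ((j + 1 : ℕ) : ℝ)) ^ ((2 : ℝ) / 3) := by
      rw [Real.div_rpow (by positivity) hj0.le, Real.rpow_neg hj0.le, div_eq_mul_inv]
      ring_nf
    simp only [hG]
    rw [e1, e2]
    gcongr
  have hsum := sum_le_sum_of_map (fun a => a - n / m)
    (fun a => (unitFractionCount 4 (m * a - n) (a * n) : ℝ)) G (fun a ha => (hterm a ha).1)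
    (fun a ha b hb hab => by
      have h1 := (hterm a ha).2.1
      have h2 := (hterm b hb).2.1
      simp only at hab
      omega) (fun a ha => (hterm a ha).2.2) (fun i _ => by positivity)
  -- Since m ≥ 1, n/m ≤ √X. The second sum is then of order X^(4/3 + 1/6) = X^(3/2), matching the
  -- first.
  have hJle : (J : ℝ) ^ ((1 : ℝ) / 3) ≤ 5 ^ ((1 : ℝ) / 3) * X ^ ((1 : ℝ) / 6) := by
    have h1 : (J : ℝ) ≤ 5 * X ^ ((1 : ℝ) / 2) := by
      calc (J : ℝ) ≤ ((5 * n : ℕ) : ℝ) / m := Nat.cast_div_le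
        _ = 5 * (n / m) := by push_cast; ring
        _ ≤ 5 * X ^ ((1 : ℝ) / 2) := by
          gcongr
          rw [← Real.sqrt_eq_rpow]
          refine Real.le_sqrt_of_sq_le ?_
          rw [hX, div_pow]
          gcongr
          nlinarith
    calc (J : ℝ) ^ ((1 : ℝ) / 3) ≤ (5 * X ^ ((1 : ℝ) / 2)) ^ ((1 : ℝ) / 3) := by gcongr
      _ = _ := by
        rw [Real.mul_rpow (by norm_num) (by positivity), ← Real.rpow_mul hX0.le]
        norm_num
  have s1 := sum_rpow_neg_three_halves_le J
  have s2 := (sum_rpow_neg_two_thirds_le J).trans (mul_le_mul_of_nonneg_left hJle (by norm_num))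
  calc (unitFractionCount 5 m n : ℝ) ≤ ∑ i ∈ Finset.Icc 1 J, G i := hrec.trans hsum
    _ = C * (5 * X) ^ ((1 : ℝ) / 10) *
        ((5 * X) ^ ((3 : ℝ) / 2) * ∑ i ∈ Finset.Icc 1 J, (i : ℝ) ^ (-(3 / 2) : ℝ) +
        (25 * X ^ 2) ^ ((2 : ℝ) / 3) * ∑ i ∈ Finset.Icc 1 J, (i : ℝ) ^ (-(2 / 3) : ℝ)) := by
        rw [Finset.mul_sum, Finset.mul_sum, ← Finset.sum_add_distrib, Finset.mul_sum]
    _ ≤ C * (5 * X) ^ ((1 : ℝ) / 10) * ((5 * X) ^ ((3 : ℝ) / 2) * 3 +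
        (25 * X ^ 2) ^ ((2 : ℝ) / 3) * (3 * (5 ^ ((1 : ℝ) / 3) * X ^ ((1 : ℝ) / 6)))) := by
        gcongr
    _ = _ := by
        have e1 : (5 * X) ^ ((1 : ℝ) / 10) = 5 ^ ((1 : ℝ) / 10) * X ^ ((1 : ℝ) / 10) :=
          Real.mul_rpow (by norm_num) hX0.le
        have e2 : (5 * X) ^ ((3 : ℝ) / 2) = 5 ^ ((3 : ℝ) / 2) * X ^ ((3 : ℝ) / 2) :=
          Real.mul_rpow (by norm_num) hX0.le
        have e3 : (25 * X ^ 2) ^ ((2 : ℝ) / 3) = 25 ^ ((2 : ℝ) / 3) * X ^ ((4 : ℝ) / 3) := by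
          rw [Real.mul_rpow (by norm_num) (by positivity), ← Real.rpow_natCast X 2,
            ← Real.rpow_mul hX0.le]
          norm_num
        have e4 : X ^ ((4 : ℝ) / 3) * X ^ ((1 : ℝ) / 6) = X ^ ((3 : ℝ) / 2) := by
          rw [← Real.rpow_add hX0]; norm_num
        have e5 : X ^ ((8 : ℝ) / 5) = X ^ ((1 : ℝ) / 10) * X ^ ((3 : ℝ) / 2) := by
          rw [← Real.rpow_add hX0]; norm_num
        rw [e1, e2, e3, e5, ← e4]
        ring

/-! ### Induction on the number of fractions -/

/-- The sum that controls the passage from `k` to `k + 1` unit fractions. -/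
theorem sum_one_add_div_sq_div_rpow_le (k n : ℕ) (hk : 1 ≤ k) (hn : 0 < n) (E : ℝ)
    (hE : (3 : ℝ) / 2 ≤ E) :
    ∑ u ∈ Finset.Icc 1 (k * n), ((1 + (u : ℝ) / n) ^ 2 / u) ^ E ≤
      (k + 3) * (((k : ℝ) + 1) ^ 2 / k) ^ E := by
  have hk' : (1 : ℝ) ≤ k := by exact_mod_cast hk
  have hk0 : (0 : ℝ) < k := by linarith
  have hn' : (1 : ℝ) ≤ n := by exact_mod_cast hn
  have hn0 : (0 : ℝ) < n := by linarith
  have hE0 : 0 ≤ E := by linarith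
  set M := ((k : ℝ) + 1) ^ 2 / k with hM
  have hM0 : 0 < M := by positivity
  have hM4 : 4 ≤ M := by
    rw [hM, le_div_iff₀ hk0]
    nlinarith [sq_nonneg ((k : ℝ) - 1)]
  have hterm : ∀ u ∈ Finset.Icc 1 (k * n), ((1 + (u : ℝ) / n) ^ 2 / u) ^ E ≤
      M ^ E * (u : ℝ) ^ (-(3 / 2) : ℝ) + M ^ E * (n : ℝ)⁻¹ := by
    intro u hu
    obtain ⟨hu1, huk⟩ := Finset.mem_Icc.mp hu
    have hu1' : (1 : ℝ) ≤ u := by exact_mod_cast hu1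
    have hu0 : (0 : ℝ) < u := by linarith
    have huk' : (u : ℝ) ≤ k * n := by exact_mod_cast huk
    -- For u ≤ n the numerator is at most 4 ≤ M, and the terms form a convergent series. For u ≥ n
    -- every term is at most M^E / n, and there are at most k n of them.
    rcases le_total (u : ℝ) n with hun | hun
    · have h1 : (1 + (u : ℝ) / n) ^ 2 / u ≤ M / u := by
        have : (u : ℝ) / n ≤ 1 := (div_le_one hn0).mpr hun
        have h0 : 0 ≤ (u : ℝ) / n := by positivity
        gcongr
        nlinarith
      have h2 : ((1 + (u : ℝ) / n) ^ 2 / u) ^ E ≤ M ^ E * (u : ℝ) ^ (-(3 / 2) : ℝ) := by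
        calc ((1 + (u : ℝ) / n) ^ 2 / u) ^ E ≤ (M / u) ^ E := by gcongr
          _ = M ^ E * (u : ℝ) ^ (-E) := by
            rw [Real.div_rpow hM0.le hu0.le, Real.rpow_neg hu0.le, ← div_eq_mul_inv]
          _ ≤ _ := by gcongr
      have : 0 ≤ M ^ E * (n : ℝ)⁻¹ := by positivity
      linarith
    · have h1 : (1 + (u : ℝ) / n) ^ 2 / u ≤ M / n := by
        have h2 : ((u : ℝ) + n) ^ 2 * k ≤ ((k : ℝ) + 1) ^ 2 * (u * n) := by
          -- The difference of the two sides is exactly (k n - u)(k u - n).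
          nlinarith [mul_nonneg (sub_nonneg.mpr huk') (show (0 : ℝ) ≤ k * u - n by nlinarith)]
        have e1 : (1 + (u : ℝ) / n) ^ 2 / u = ((u : ℝ) + n) ^ 2 / (n ^ 2 * u) := by
          field_simp; ring
        have e2 : M / n = ((k : ℝ) + 1) ^ 2 / (k * n) := by rw [hM]; field_simp
        rw [e1, e2, div_le_div_iff₀ (by positivity) (by positivity)]
        calc ((u : ℝ) + n) ^ 2 * (k * n) = ((u : ℝ) + n) ^ 2 * k * n := by ring
          _ ≤ ((k : ℝ) + 1) ^ 2 * (u * n) * n := by gcongr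
          _ = _ := by ring
      have h2 : ((1 + (u : ℝ) / n) ^ 2 / u) ^ E ≤ M ^ E * (n : ℝ)⁻¹ := by
        calc ((1 + (u : ℝ) / n) ^ 2 / u) ^ E ≤ (M / n) ^ E := by gcongr
          _ = M ^ E * (n : ℝ) ^ (-E) := by
            rw [Real.div_rpow hM0.le hn0.le, Real.rpow_neg hn0.le, ← div_eq_mul_inv]
          _ ≤ M ^ E * (n : ℝ) ^ (-1 : ℝ) := by
            gcongr
            linarith
          _ = _ := by rw [Real.rpow_neg_one]
      have : 0 ≤ M ^ E * (u : ℝ) ^ (-(3 / 2) : ℝ) := by positivity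
      linarith
  have hME : 0 ≤ M ^ E := by positivity
  calc ∑ u ∈ Finset.Icc 1 (k * n), ((1 + (u : ℝ) / n) ^ 2 / u) ^ E
      ≤ ∑ u ∈ Finset.Icc 1 (k * n), (M ^ E * (u : ℝ) ^ (-(3 / 2) : ℝ) + M ^ E * (n : ℝ)⁻¹) :=
        Finset.sum_le_sum hterm
    _ = M ^ E * ∑ u ∈ Finset.Icc 1 (k * n), (u : ℝ) ^ (-(3 / 2) : ℝ) + k * M ^ E := by
        rw [Finset.sum_add_distrib, ← Finset.mul_sum, Finset.sum_const, Nat.card_Icc, nsmul_eq_mul]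
        push_cast [Nat.add_sub_cancel]
        field_simp
    _ ≤ M ^ E * 3 + k * M ^ E := by
        gcongr
        exact sum_rpow_neg_three_halves_le _
    _ = _ := by ring

/-- Passage from `k` to `k + 1` unit fractions. -/
theorem unitFractionCount_succ_le_of_forall_le {k : ℕ} (hk : 1 ≤ k) {B E : ℝ} (hB : 0 ≤ B)
    (hE : (3 : ℝ) / 2 ≤ E)
    (h : ∀ m n : ℕ, 0 < m → 0 < n →
      (unitFractionCount k m n : ℝ) ≤ B * ((k : ℝ) ^ ((4 : ℝ) / 3) * (n : ℝ) ^ 2 / m) ^ E)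
    {R : ℝ} (hR : (k + 3 : ℝ) ≤ R * (((k : ℝ) + 1) ^ 2 / k) ^ (E / 3))
    {m n : ℕ} (hm : 0 < m) (hn : 0 < n) :
    (unitFractionCount (k + 1) m n : ℝ) ≤
      R * B * (((k : ℝ) + 1) ^ ((4 : ℝ) / 3) * (n : ℝ) ^ 2 / m) ^ (2 * E) := by
  have hm0 : (0 : ℝ) < m := by exact_mod_cast hm
  have hn0 : (0 : ℝ) < n := by exact_mod_cast hn
  have hk0 : (0 : ℝ) < k := by exact_mod_cast hk
  set X : ℝ := (n : ℝ) ^ 2 / m with hX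
  have hX0 : 0 < X := by positivity
  set K : ℝ := (k : ℝ) ^ ((4 : ℝ) / 3) with hK
  have hK0 : 0 < K := by positivity
  have hrec : (unitFractionCount (k + 1) m n : ℝ) ≤
      ∑ a ∈ (Finset.Icc 1 ((k + 1) * n / m)).filter (fun a => n < m * a),
        (unitFractionCount k (m * a - n) (a * n) : ℝ) := by
    exact_mod_cast unitFractionCount_succ_le k m n hk hm hn
  -- Reindexing by u = m a - n turns a n into X(1 + u/n), which separates X from u.
  have hsum := sum_le_sum_of_map (s := (Finset.Icc 1 ((k + 1) * n / m)).filter (fun a => n < m * a))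
    (t := Finset.Icc 1 (k * n)) (fun a => m * a - n)
    (fun a => (unitFractionCount k (m * a - n) (a * n) : ℝ))
    (fun u => B * (K * X ^ 2) ^ E * ((1 + (u : ℝ) / n) ^ 2 / u) ^ E)
    (fun a ha => by
      obtain ⟨ha, hlt⟩ := Finset.mem_filter.mp ha
      have h1 := (Nat.le_div_iff_mul_le hm).mp (Finset.mem_Icc.mp ha).2
      have h2 : m * a ≤ k * n + n := by linarith
      exact Finset.mem_Icc.mpr ⟨by omega, by omega⟩)
    (fun a ha b hb hab => by
      have h1 : n < m * a := (Finset.mem_filter.mp ha).2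
      have h2 : n < m * b := (Finset.mem_filter.mp hb).2
      simp only at hab
      exact Nat.eq_of_mul_eq_mul_left hm (by omega))
    (fun a ha => by
      obtain ⟨ha, hlt⟩ := Finset.mem_filter.mp ha
      have ha1 := (Finset.mem_Icc.mp ha).1
      refine (h (m * a - n) (a * n) (by omega) (Nat.mul_pos ha1 hn)).trans (le_of_eq ?_)
      have hu : ((m * a - n : ℕ) : ℝ) = m * a - n := by
        rw [Nat.cast_sub hlt.le]; push_cast; ring
      have hu0 : (0 : ℝ) < m * a - n := by
        rw [← hu]
        exact_mod_cast Nat.sub_pos_of_lt hlt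
      rw [mul_assoc, ← Real.mul_rpow (by positivity) (by positivity), hu]
      congr 2
      have e : 1 + ((m : ℝ) * a - n) / n = m * a / n := by field_simp; ring
      rw [e, hX]
      push_cast
      field_simp)
    (fun u _ => by positivity)
  have hbound := sum_one_add_div_sq_div_rpow_le k n hk hn E hE
  set M := ((k : ℝ) + 1) ^ 2 / k with hM
  have hM0 : 0 < M := by positivity
  calc (unitFractionCount (k + 1) m n : ℝ)
      ≤ B * (K * X ^ 2) ^ E *
        ∑ u ∈ Finset.Icc 1 (k * n), ((1 + (u : ℝ) / n) ^ 2 / u) ^ E := by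
        rw [Finset.mul_sum]
        exact hrec.trans hsum
    _ ≤ B * (K * X ^ 2) ^ E * ((k + 3) * M ^ E) := by gcongr
    _ ≤ B * (K * X ^ 2) ^ E * (R * M ^ (E / 3) * M ^ E) := by gcongr
    _ = R * B * ((K * X ^ 2) ^ E * M ^ ((4 / 3) * E)) := by
        have : M ^ ((4 / 3) * E) = M ^ (E / 3) * M ^ E := by
          rw [← Real.rpow_add hM0]; ring_nf
        rw [this]; ring
    _ = _ := by
        -- The exponent 4/3 is what makes k cancel: k^(4/3) M^(4/3) = ((k+1)^(4/3))².
        congr 1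
        rw [Real.rpow_mul hM0.le, Real.rpow_mul (by positivity),
          ← Real.mul_rpow (by positivity) (by positivity), hM,
          Real.div_rpow (by positivity) hk0.le, ← hK]
        congr 1
        have e : (((k : ℝ) + 1) ^ 2) ^ ((4 : ℝ) / 3) = (((k : ℝ) + 1) ^ ((4 : ℝ) / 3)) ^ 2 := by
          rw [← Real.rpow_natCast, ← Real.rpow_natCast, ← Real.rpow_mul (by positivity),
            ← Real.rpow_mul (by positivity), mul_comm]
        rw [e, mul_div_assoc, ← hX, Real.rpow_two]
        field_simp

/-- The base is at least x + 2 and E/3 ≥ 16/15, so the surplus is (x+2)^(1/15) ≥ 8^(1/15) ≥ 9/8 ≥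
(x+3)/(x+2). The value 16/5 is the exponent reached at six fractions. -/
theorem add_three_le_rpow {x E : ℝ} (hx : 6 ≤ x) (hE : (16 : ℝ) / 5 ≤ E) :
    x + 3 ≤ ((x + 1) ^ 2 / x) ^ (E / 3) := by
  have hx0 : 0 < x := by linarith
  have h1 : x + 2 ≤ (x + 1) ^ 2 / x := by
    rw [le_div_iff₀ hx0]; nlinarith
  have h2 : (9 : ℝ) / 8 ≤ (x + 2) ^ ((1 : ℝ) / 15) := by
    have h3 : ((9 : ℝ) / 8) ^ (15 : ℝ) ≤ x + 2 := by
      calc ((9 : ℝ) / 8) ^ (15 : ℝ) = ((9 : ℝ) / 8) ^ 15 := by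
            rw [← Real.rpow_natCast]; norm_num
        _ ≤ 8 := by norm_num
        _ ≤ _ := by linarith
    calc (9 : ℝ) / 8 = (((9 : ℝ) / 8) ^ (15 : ℝ)) ^ ((1 : ℝ) / 15) := by
          rw [← Real.rpow_mul (by norm_num)]; norm_num
      _ ≤ _ := Real.rpow_le_rpow (by positivity) h3 (by norm_num)
  calc x + 3 ≤ (x + 2) * (9 / 8) := by linarith
    _ ≤ (x + 2) * (x + 2) ^ ((1 : ℝ) / 15) := by gcongr
    _ = (x + 2) ^ ((16 : ℝ) / 15) := by
        rw [← Real.rpow_one_add' (by positivity) (by norm_num)]; norm_num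
    _ ≤ (x + 2) ^ (E / 3) := Real.rpow_le_rpow_of_exponent_le (by linarith) (by linarith)
    _ ≤ _ := Real.rpow_le_rpow (by positivity) h1 (by linarith)

/-- A bound for the number of representations that is uniform in `k` and needs no factor
`(k n) ^ ε`. -/
theorem exists_unitFractionCount_le :
    ∃ C : ℝ, 0 < C ∧ ∀ k m n : ℕ, 5 ≤ k → 0 < m → 0 < n →
      (unitFractionCount k m n : ℝ) ≤ C * ((k : ℝ) ^ ((4 : ℝ) / 3) * (n : ℝ) ^ 2 / m) ^
        ((8 : ℝ) / 5 * (2 : ℝ) ^ (k - 5)) := by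
  obtain ⟨C, hC, hfive⟩ := exists_unitFractionCount_five_le
  have h5 : ∀ m n : ℕ, 0 < m → 0 < n → (unitFractionCount 5 m n : ℝ) ≤
      C * (((5 : ℕ) : ℝ) ^ ((4 : ℝ) / 3) * (n : ℝ) ^ 2 / m) ^ ((8 : ℝ) / 5) := by
    intro m n hm hn
    refine (hfive m n hm hn).trans ?_
    have : (1 : ℝ) ≤ ((5 : ℕ) : ℝ) ^ ((4 : ℝ) / 3) := Real.one_le_rpow (by norm_num) (by norm_num)
    gcongr
    exact le_mul_of_one_le_left (by positivity) this
  -- The step from 5 to 6 has too small an exponent for `add_three_le_rpow` and pays R = 5 + 3 = 8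
  -- once. Every later step has R = 1.
  have h6 : ∀ k : ℕ, ∀ m n : ℕ, 0 < m → 0 < n → (unitFractionCount (k + 6) m n : ℝ) ≤
      8 * C * (((k + 6 : ℕ) : ℝ) ^ ((4 : ℝ) / 3) * (n : ℝ) ^ 2 / m) ^
        ((8 : ℝ) / 5 * (2 : ℝ) ^ (k + 1)) := by
    intro k
    induction k with
    | zero =>
      intro m n hm hn
      have := unitFractionCount_succ_le_of_forall_le (by norm_num) hC.le (by norm_num) h5
        (R := 8) (by
          have : (1 : ℝ) ≤ ((((5 : ℕ) : ℝ) + 1) ^ 2 / (5 : ℕ)) ^ ((8 : ℝ) / 5 / 3) :=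
            Real.one_le_rpow (by norm_num) (by norm_num)
          push_cast at this ⊢
          linarith) hm hn
      convert this using 3
      · norm_num
      · norm_num
    | succ k ih =>
      intro m n hm hn
      have hpow : (2 : ℝ) ≤ 2 ^ (k + 1) := by
        have := pow_le_pow_right₀ (show (1 : ℝ) ≤ 2 by norm_num) (show 1 ≤ k + 1 by omega)
        simpa using this
      have := unitFractionCount_succ_le_of_forall_le (by omega) (by positivity)
        (by linarith) ih (R := 1) (by
          rw [one_mul]
          refine add_three_le_rpow ?_ (by linarith)
          push_cast
          linarith [Nat.cast_nonneg (α := ℝ) k]) hm hn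
      rw [one_mul] at this
      convert this using 3
      · push_cast; ring_nf
      · ring
  refine ⟨8 * C, by positivity, fun k m n hk hm hn => ?_⟩
  obtain ⟨k, rfl⟩ := Nat.exists_eq_add_of_le' hk
  rcases k with _ | k
  · have := h5 m n hm hn
    simp only [zero_add, Nat.sub_self, pow_zero, mul_one]
    refine this.trans ?_
    gcongr
    linarith
  · have := h6 k m n hm hn
    rw [show k + 1 + 5 = k + 6 by ring, show k + 6 - 5 = k + 1 by omega]
    exact this

theorem theorem2 :
    ∀ ε : ℝ, 0 < ε → ∃ C : ℝ, 0 < C ∧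
      ∀ k m n : ℕ, 5 ≤ k → 0 < m → 0 < n →
        (unitFractionCount k m n : ℝ) ≤
          C * ((k : ℝ) * (n : ℝ)) ^ ε *
            ((k : ℝ) ^ ((4 : ℝ) / 3) * (n : ℝ) ^ 2 / (m : ℝ)) ^
              ((8 : ℝ) / 5 * (2 : ℝ) ^ (k - 5)) := by
  intro ε hε
  obtain ⟨C, hC, h⟩ := exists_unitFractionCount_le
  refine ⟨C, hC, fun k m n hk hm hn => (h k m n hk hm hn).trans ?_⟩
  have h1 : (1 : ℝ) ≤ (k : ℝ) * n := by exact_mod_cast Nat.mul_pos (by omega : 0 < k) hn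
  -- The ε-factor is at least 1, so it only weakens the uniform bound.
  have h2 : (1 : ℝ) ≤ ((k : ℝ) * n) ^ ε := Real.one_le_rpow h1 hε.le
  gcongr
  exact le_mul_of_one_le_right hC.le h2
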